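/- **Protocol (APM-BRB).** There are $n=3f+1$ nodes $P_1,\dots,P_n$, of which a set of $f$ nodes, fixed in advance, is Byzantine; the others are honest. Nodes exchange packets over authenticated point-to-point channels; every packet sent to an honest node is eventually received, and an honest node eventually performs every step that stays possible. Signatures, threshold signatures and hashes are ideal (unforgeable, collision-free). For each sender $P_i$ and round $r\ge 1$ there is a public committee $N_c(i,r)$ of $n_c$ nodes, which is random and depends only on $i$ and $r \bmod \varphi$ ($\varphi\geq 1$). A certificate $\mathrm{cert}(m)$ of a message $m=m_r^i$ of sender $P_i$ and round $r$ is a threshold signature made of signature shares on $m$ of $\lfloor n_c/2\rfloor+1$ distinct members of $N_c(i,r)$. Every node keeps lists $\mathrm{promises}[i]$ of messages of $P_i$ of rounds $1,2,\dots$, each containing the certificate of the one before, which can only be extended; and an array $\mathrm{triggers}[]$ with at most one certificate for each sender. An honest node acts as follows. * *Sending.* In round $1$, $P_i$ sends $m_1^i$ to $N_c(i,1)$. For $r\ge2$, it waits for $\mathrm{cert}(m_{r-1}^i)$ and until, for some set $J$ of $2f+1$ nodes $P_j$, $\mathrm{promises}[j]$ has reached round $r-1$ and the certificate of $\mathrm{promises}[j][r-1]$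 is known (it requests missing messages and certificates from the $P_j$); then it sends to $N_c(i,r)$ the message $m_r^i$ made of its content, $\mathrm{cert}(m_{r-1}^i)$, the set $\mathrm{prev}\{\}$ of the certificates of $\mathrm{promises}[j][r-1]$, $j\in J$, and its current $\mathrm{triggers}[]$. * *Signing.* A member of $N_c(i,r)$ considers only the first message $m_r^i$ of $P_i$ for round $r$ it receives. It extends $\mathrm{promises}[i]$ up to round $r-1$ by requesting missing messages from their committees, and if $r=1$ or $m_r^i$ contains the certificate of $\mathrm{promises}[i][r-1]$, it re-sends $m_r^i$ to $N_c(i,r)$ and sends its signature share on $m_r^i$ to all nodes. * *Deliver condition 1.* On obtaining a certificate of a message $m_r^i$ with $r\ge\varphi$ (from enough signature shares, from $P_i$, or from the $\mathrm{triggers}[]$ of a delivered message), the node stores it in $\mathrm{triggers}[i]$ unless a certificate of the same or a later round is there; it then retrieves from the committees, walking backwards along the certificates contained in the messages, the chain $m_r^i, m_{r-1}^i,\dots,m_1^i$, and calls $\textsc{Deliver}_i(m_u^i,u)$ for $u=r-\varphi,\dots,1$ unless it has already delivered a message of $P_i$ for round $u$. * *Deliver condition 2.* If the node has certified messages $m_r^j$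 of all $n$ nodes $P_j$ for one round $r$, or has delivered messages $m_r^j$ of $2f+1$ distinct nodes $P_j$ for one round $r$, and a certificate of some $m_{r-1}^i$ is in $\mathrm{prev}\{\}$ of all of them, it retrieves in the same way and delivers $m_u^i$ for $u=r-1,\dots,1$. * Requests are answered with every fitting message the node has. Byzantine nodes may send any packets that can be produced without breaking the cryptography. **Standing assumptions.** The parameters are such that with probability at least $1-\varepsilon$ both of the following hold: (a) every committee $N_c(i,r)$ has more than $n_c/2$ honest members; (b) for every sender $P_i$ and round $r\ge1$, whenever certified messages $m_r^i,\dots,m_{r+\varphi}^i$ of $P_i$ form a chain (each contains the certificate of the one before), at least $f+1$ distinct honest nodes sign at least one of the messages $m_{r+1}^i,\dots,m_{r+\varphi}^i$. **Lemma (Totality).** Under these assumptions, with probability at least $1-\varepsilon$ the following holds for every sender $P_i$, honest or Byzantine, every round $r$ and every message $m$: if some honest node calls $\textsc{Deliver}_i(m,r)$, then every honest node eventually calls $\textsc{Deliver}_i(m,r)$. -/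

import Mathlib

open MeasureTheory

/-! The asynchronous protocol APM-BRB as a transition system: `n = 3 f + 1` nodes, `f` of them
Byzantine, with ideal (symbolic) signatures, threshold signatures and hashes. -/

namespace APMBRB

/-- The nodes `P_1, …, P_n`, `n = 3 f + 1`. -/
abbrev Node (f : ℕ) : Type := Fin (3 * f + 1)

/-- A protocol message `m_r^i`, signed by its sender `i`.
A message that occurs in one of the last three fields stands for its certificate `cert(m)`, an
`(n_c/2+1, N_c)` threshold signature on it; `none` stands for a missing (or invalid) certificate.
* `parent` is `cert(m_{r-1}^i)`;
* `prev` is the set `prev{}`, at most one certificate of each node;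
* `triggers` is the array `triggers[]`; the round number kept with a certificate is the round of the
  certified message. -/
inductive Msg (f : ℕ) (α : Type*)
  | mk (body : α) (sender : Node f) (round : ℕ) (parent : Option (Msg f α))
      (prev triggers : Node f → Option (Msg f α))

variable {f : ℕ} {α : Type*}

namespace Msg

/-- The sender `i` of `m_r^i`. -/
def sender : Msg f α → Node f
  | mk _ i _ _ _ _ => i

/-- The round `r` of `m_r^i`. -/
def round : Msg f α → ℕ
  | mk _ _ r _ _ _ => r

/-- The certificate of the sender's message of the previous round. -/
def parent : Msg f α → Option (Msg f α)
  | mk _ _ _ p _ _ => p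

/-- The certificates of messages of the previous round, by node. -/
def prev : Msg f α → Node f → Option (Msg f α)
  | mk _ _ _ _ q _ => q

/-- The certificates on which the sender has acted, by node. -/
def triggers : Msg f α → Node f → Option (Msg f α)
  | mk _ _ _ _ _ g => g

/-- The certificate of `c` is contained in `m`. -/
def Contains (m c : Msg f α) : Prop :=
  m.parent = some c ∨ (∃ j, m.prev j = some c) ∨ ∃ j, m.triggers j = some c

/-- `m = m_r^i` contains, as the certificate for round `r - 1`, that of `p = m_{r-1}^i`. -/
def Extends (m p : Msg f α) : Prop :=
  m.parent = some p ∧ p.sender = m.sender ∧ p.round + 1 = m.round ∧ 1 ≤ p.round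

end Msg

/-- What is sent over the network. -/
inductive Packet (f : ℕ) (α : Type*)
  /-- the protocol message `(m_r^i, r, i)`, from its sender or re-sent by a committee member -/
  | propose (m : Msg f α)
  /-- the signature share of node `k` on `m` -/
  | share (m : Msg f α) (k : Node f)
  /-- the certificate of `m` -/
  | cert (m : Msg f α)
  /-- a request for a message `m_y^i` that contains the certificate of `p` (of nothing in particular
  if `p = none`), together with its own certificate if `withCert = true` -/
  | askNext (i : Node f) (y : ℕ) (p : Option (Msg f α)) (withCert : Bool)
  /-- a request for the message that a given certificate certifies -/
  | fetch (c : Msg f α)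
  /-- a message sent in answer to a request -/
  | reply (m : Msg f α)

/-- The parameters of the protocol: the statically corrupted nodes, the number `φ` of rounds after
which committees repeat, the committee size `n_c`, and the sampled committees. -/
structure Setup (f : ℕ) where
  byz : Finset (Node f)
  φ : ℕ
  nc : ℕ
  sample : Node f → ℕ → Finset (Node f)

/-- `sampleCommittee(i, r)`. -/
def Setup.committee (S : Setup f) (i : Node f) (r : ℕ) : Finset (Node f) :=
  S.sample i (r % S.φ)

/-- The threshold `n_c/2 + 1`. -/
def Setup.threshold (S : Setup f) : ℕ := S.nc / 2 + 1

/-- The local state of a node. -/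
structure NodeState (f : ℕ) (α : Type*) where
  /-- packets received, with the node from which they came -/
  inbox : Set (Node f × Packet f α)
  /-- the node's own messages of rounds `1, 2, …` sent so far -/
  out : List (Msg f α)
  /-- `promises[i]`: a chain of messages of `P_i` of rounds `1, 2, …`; it can only be extended -/
  promises : Node f → List (Msg f α)
  /-- `triggers[]` -/
  triggers : Node f → Option (Msg f α)
  /-- the first message of `P_i` for round `r` received as a member of its committee -/
  accepted : Node f → ℕ → Option (Msg f α)
  /-- the messages on which the node has issued a signature share -/
  signed : Set (Msg f α)
  /-- `(d, c)`: some loop that walks back along a chain of certificates, and delivers the messages of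
  rounds at most `d`, has reached the certificate of `c` (its variable `tempCert`) -/
  jobs : Set (ℕ × Msg f α)
  /-- `delivered i r = some m`: the node has called `Deliver_i(m, r)` -/
  delivered : Node f → ℕ → Option (Msg f α)

/-- The initial local state. -/
def NodeState.start : NodeState f α where
  inbox := ∅
  out := []
  promises := fun _ => []
  triggers := fun _ => none
  accepted := fun _ _ => none
  signed := ∅
  jobs := ∅
  delivered := fun _ _ => none

namespace NodeState

/-- The node has the message `m`: received, or sent by itself. -/
def Holds (ns : NodeState f α) (m : Msg f α) : Prop :=
  (∃ src, (src, Packet.propose m) ∈ ns.inbox) ∨ (∃ src, (src, Packet.reply m) ∈ ns.inbox) ∨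
    m ∈ ns.out

/-- The node has obtained `cert(m)`: from `n_c/2 + 1` signature shares of distinct members of the
committee, or from the sender of `m`. -/
def HasCert (S : Setup f) (ns : NodeState f α) (m : Msg f α) : Prop :=
  (∃ K ⊆ S.committee m.sender m.round, S.threshold ≤ K.card ∧
      ∀ k ∈ K, ∃ src, (src, Packet.share m k) ∈ ns.inbox) ∨
    (m.sender, Packet.cert m) ∈ ns.inbox

/-- `m` is an admissible answer of the node to a request. -/
def Answers (S : Setup f) (ns : NodeState f α) : Packet f α → Msg f α → Prop
  | .askNext i y p withCert, m =>
      m.sender = i ∧ m.round = y ∧ (p = none ∨ m.parent = p) ∧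
        (withCert = true → ns.HasCert S m)
  | .fetch c, m => m = c
  | _, _ => False

/-- `syncMsg(r, i)` is running, or has run, for some `r ≥ y`. -/
def Syncing (ns : NodeState f α) (i : Node f) (y : ℕ) : Prop :=
  ∃ r, y < r ∧ ns.accepted i r ≠ none

/-- The effect of `Deliver_i(m, r)` if not already delivered: nothing changes if a message was
delivered for `(i, r)` before. -/
noncomputable def deliver (ns : NodeState f α) (m : Msg f α) : NodeState f α :=
  { ns with delivered := fun i r => open Classical in
      if i = m.sender ∧ r = m.round ∧ ns.delivered i r = none then some m else ns.delivered i r }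

/-- The update of `triggers[]` by the certificate of `c`: only if there is no entry for that sender,
or one of an earlier round. -/
noncomputable def trigger (ns : NodeState f α) (c : Msg f α) : NodeState f α :=
  { ns with triggers := fun i => open Classical in
      if i = c.sender ∧ ∀ c₀, ns.triggers i = some c₀ → c₀.round < c.round then some c
      else ns.triggers i }

end NodeState

/-- Names of the local actions of an honest node. -/
inductive Action (f : ℕ) (α : Type*)
  | send
  | accept (m : Msg f α)
  | sign (m : Msg f α)
  | askSync (i : Node f)
  | askReq (i : Node f)
  | promise (m : Msg f α)
  | answer (dst : Node f) (q : Packet f α) (m : Msg f α)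
  | fetch (c : Msg f α)
  | runCert (c : Msg f α)
  | advance (d : ℕ) (c : Msg f α)
  | optimistic (c : Msg f α)
  | quorum (c : Msg f α)

open NodeState in
/-- `LocalStep S self ns a ns' o`: the honest node `self` in local state `ns` may perform `a`, which
leads to the local state `ns'` and emits the packets (with their destinations) in `o`. -/
inductive LocalStep (S : Setup f) (self : Node f) :
    NodeState f α → Action f α → NodeState f α → Set (Node f × Packet f α) → Prop
  /-- The message of round 1 is sent to its committee. -/
  | sendFirst (ns : NodeState f α) (body : α) (m : Msg f α)
      (h : ns.out = [])
      (hm : m = .mk body self 1 none (fun _ => none) ns.triggers) :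
      LocalStep S self ns .send { ns with out := [m] }
        {x | x.1 ∈ S.committee self 1 ∧ x.2 = .propose m}
  /-- The message of round `r + 1` is sent, once the certificate of the own message `p` of round `r`
  is there and `reqMsg(r, j)` has completed for the `2f+1` nodes `j` in `J`. -/
  | sendNext (ns : NodeState f α) (body : α) (p m : Msg f α) (J : Finset (Node f))
      (prev : Node f → Option (Msg f α))
      (hp : ns.out.getLast? = some p) (hcert : ns.HasCert S p)
      (hJ : J.card = 2 * f + 1)
      (hprev : ∀ j ∈ J, ∃ c, (ns.promises j)[ns.out.length - 1]? = some c ∧ ns.HasCert S c ∧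
        prev j = some c)
      (hprev0 : ∀ j ∉ J, prev j = none)
      (hm : m = .mk body self (ns.out.length + 1) (some p) prev ns.triggers) :
      LocalStep S self ns .send { ns with out := ns.out ++ [m] }
        {x | x.1 ∈ S.committee self (ns.out.length + 1) ∧ x.2 = .propose m}
  /-- A committee member takes up the first message of `P_i` for round `r` that it receives. -/
  | accept (ns : NodeState f α) (m : Msg f α) (src : Node f)
      (hrecv : (src, .propose m) ∈ ns.inbox) (hround : 1 ≤ m.round)
      (hcom : self ∈ S.committee m.sender m.round)
      (hnew : ns.accepted m.sender m.round = none) :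
      LocalStep S self ns (.accept m)
        { ns with accepted := fun i r => open Classical in
            if i = m.sender ∧ r = m.round then some m else ns.accepted i r } ∅
  /-- The taken-up message `m_r^i` is re-sent to the committee and a signature share on it is sent to
  all nodes, if `m_r^i` contains the certificate of `syncMsg(r-1, i) = promises[i][r-1]`. -/
  | sign (ns : NodeState f α) (m : Msg f α)
      (hacc : ns.accepted m.sender m.round = some m)
      (hext : m.round = 1 ∨
        ∃ p, m.parent = some p ∧ (ns.promises m.sender)[m.round - 2]? = some p) :
      LocalStep S self ns (.sign m) { ns with signed := insert m ns.signed }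
        {x | (x.1 ∈ S.committee m.sender m.round ∧ x.2 = .propose m) ∨ x.2 = .share m self}
  /-- `syncMsg` requests the next missing message of `P_i` from its committee. -/
  | askSync (ns : NodeState f α) (i : Node f) (y : ℕ)
      (hy : y = (ns.promises i).length + 1) (h : ns.Syncing i y) :
      LocalStep S self ns (.askSync i) ns
        {x | x.1 ∈ S.committee i y ∧ x.2 = .askNext i y (ns.promises i).getLast? false}
  /-- `reqMsg(r, i)`, invoked after the own message of round `r` has been sent, requests the next
  missing message of `P_i` from `P_i`, with its certificate in the case of round `r`. -/
  | askReq (ns : NodeState f α) (i : Node f) (y : ℕ)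
      (hy : y = (ns.promises i).length + 1) (h : y ≤ ns.out.length) :
      LocalStep S self ns (.askReq i) ns
        {x | x.1 = i ∧ x.2 = .askNext i y (ns.promises i).getLast? (decide (y = ns.out.length))}
  /-- `syncMsg` or `reqMsg` receives the next message of a chain and writes it to `promises`. -/
  | promise (ns : NodeState f α) (m : Msg f α)
      (hround : m.round = (ns.promises m.sender).length + 1)
      (hext : ns.promises m.sender = [] ∨ m.parent = (ns.promises m.sender).getLast?)
      (h : (ns.Syncing m.sender m.round ∧
            ∃ src ∈ S.committee m.sender m.round, (src, .reply m) ∈ ns.inbox) ∨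
          (m.round ≤ ns.out.length ∧ (m.sender, .reply m) ∈ ns.inbox ∧
            (m.round = ns.out.length → ns.HasCert S m))) :
      LocalStep S self ns (.promise m)
        { ns with promises :=
            Function.update ns.promises m.sender (ns.promises m.sender ++ [m]) } ∅
  /-- A request is answered with a fitting message that the node has (and its certificate, if the
  request asks for it). -/
  | answer (ns : NodeState f α) (dst : Node f) (q : Packet f α) (m : Msg f α)
      (hq : (dst, q) ∈ ns.inbox) (hm : ns.Holds m) (h : ns.Answers S q m) :
      LocalStep S self ns (.answer dst q m) ns
        {x | x.1 = dst ∧ (x.2 = .reply m ∨ (∃ i y p, q = .askNext i y p true) ∧ x.2 = .cert m)}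
  /-- The message belonging to a certificate is requested from its committee. -/
  | fetch (ns : NodeState f α) (c : Msg f α)
      (h : ns.HasCert S c ∨ ∃ d, (d, c) ∈ ns.jobs) :
      LocalStep S self ns (.fetch c) ns
        {x | x.1 ∈ S.committee c.sender c.round ∧ x.2 = .fetch c}
  /-- Deliver condition 1: `processCertificate` is called for the certificate of `c`, which has been
  obtained or is contained in the `triggers[]` of a delivered message. -/
  | runCert (ns : NodeState f α) (c : Msg f α)
      (h : ns.HasCert S c ∨
        ∃ i r m, ns.delivered i r = some m ∧ m.triggers c.sender = some c)
      (hφ : S.φ ≤ c.round) :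
      LocalStep S self ns (.runCert c)
        { ns.trigger c with jobs := insert (c.round - S.φ, c) ns.jobs } ∅
  /-- One iteration of a loop that walks back along a chain: the message `c` has been obtained; it is
  delivered if its round is at most `d` (no further message for the same sender and round is
  delivered); the walk continues with the certificate in `c` of the previous round. -/
  | advance (ns ns₁ : NodeState f α) (d : ℕ) (c : Msg f α)
      (h : (d, c) ∈ ns.jobs) (hc : ns.Holds c)
      (h₁ : (c.round ≤ d ∧ 1 ≤ c.round ∧ ns₁ = ns.deliver c) ∨
        (¬(c.round ≤ d ∧ 1 ≤ c.round) ∧ ns₁ = ns)) :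
      LocalStep S self ns (.advance d c)
        { ns₁ with jobs := ns.jobs ∪ {x | x.1 = d ∧ c.Extends x.2} } ∅
  /-- Deliver condition 2, first part: certified messages of all `n` nodes in one round have been
  collected, and all of them contain the certificate of `c` in `prev{}`. -/
  | optimistic (ns : NodeState f α) (c : Msg f α) (M : Node f → Msg f α)
      (hround : 1 ≤ c.round)
      (hM : ∀ j, (M j).sender = j ∧ (M j).round = c.round + 1 ∧ ns.HasCert S (M j) ∧
        ns.Holds (M j) ∧ (M j).prev c.sender = some c) :
      LocalStep S self ns (.optimistic c)
        { ns with jobs := insert (c.round, c) ns.jobs } ∅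
  /-- Deliver condition 2, second part: messages of `2f+1` distinct nodes in one round have been
  delivered, and all of them contain the certificate of `c` in `prev{}`. -/
  | quorum (ns : NodeState f α) (c : Msg f α) (J : Finset (Node f))
      (hround : 1 ≤ c.round) (hJ : J.card = 2 * f + 1)
      (hM : ∀ j ∈ J, ∃ m, ns.delivered j (c.round + 1) = some m ∧ m.prev c.sender = some c) :
      LocalStep S self ns (.quorum c)
        { ns with jobs := insert (c.round, c) ns.jobs } ∅

/-- A global state: the local states and all packets sent so far, as (source, destination, packet). -/
structure State (f : ℕ) (α : Type*) where
  node : Node f → NodeState f α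
  net : Set (Node f × Node f × Packet f α)

/-- The initial global state. -/
def State.start : State f α where
  node := fun _ => NodeState.start
  net := ∅

namespace State

/-- A valid certificate of `m` can exist: `n_c/2 + 1` members of its committee are Byzantine or have
issued their signature share on `m`. -/
def CertAvailable (S : Setup f) (s : State f α) (m : Msg f α) : Prop :=
  ∃ K ⊆ S.committee m.sender m.round, S.threshold ≤ K.card ∧
    ∀ k ∈ K, k ∈ S.byz ∨ m ∈ (s.node k).signed

/-- `m` with the valid signature of its sender can be produced by the adversary: an honest sender has
sent it, or the sender is Byzantine and all certificates in `m` are available. -/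
def Authentic (S : Setup f) (s : State f α) (m : Msg f α) : Prop :=
  if m.sender ∈ S.byz then ∀ c, m.Contains c → s.CertAvailable S c
  else m ∈ (s.node m.sender).out

/-- The packets that the adversary can produce without breaking the cryptography. -/
def Derivable (S : Setup f) (s : State f α) : Packet f α → Prop
  | .propose m => s.Authentic S m
  | .reply m => s.Authentic S m
  | .share m k => k ∈ S.byz ∨ m ∈ (s.node k).signed
  | .cert m => s.CertAvailable S m
  | .askNext _ _ _ _ => True
  | .fetch _ => True

end State

/-- Events of an execution: nothing happens; a packet arrives; an honest node performs a local action;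
a Byzantine node sends a packet. -/
inductive Event (f : ℕ) (α : Type*)
  | idle
  | recv (src dst : Node f) (pkt : Packet f α)
  | act (j : Node f) (a : Action f α)
  | byz (src dst : Node f) (pkt : Packet f α)

/-- The transitions of the whole system. -/
inductive Step (S : Setup f) : State f α → Event f α → State f α → Prop
  | idle (s : State f α) : Step S s .idle s
  | recv (s : State f α) (src dst : Node f) (pkt : Packet f α)
      (h : (src, dst, pkt) ∈ s.net) :
      Step S s (.recv src dst pkt)
        { node := Function.update s.node dst
            { (s.node dst) with inbox := insert (src, pkt) (s.node dst).inbox }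
          net := s.net }
  | act (s : State f α) (j : Node f) (a : Action f α) (ns : NodeState f α)
      (o : Set (Node f × Packet f α)) (hj : j ∉ S.byz)
      (h : LocalStep S j (s.node j) a ns o) :
      Step S s (.act j a)
        { node := Function.update s.node j ns
          net := s.net ∪ {x | x.1 = j ∧ x.2 ∈ o} }
  | byz (s : State f α) (src dst : Node f) (pkt : Packet f α)
      (hsrc : src ∈ S.byz) (h : s.Derivable S pkt) :
      Step S s (.byz src dst pkt) { s with net := insert (src, dst, pkt) s.net }

/-- `s 0, s 1, …` is an execution of APM-BRB: every packet sent to an honest node eventually arrives,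
and an honest node eventually performs each action that stays possible. -/
structure IsExecution (S : Setup f) (s : ℕ → State f α) (e : ℕ → Event f α) : Prop where
  start : s 0 = State.start
  step : ∀ t, Step S (s t) (e t) (s (t + 1))
  arrives : ∀ t src dst pkt, (src, dst, pkt) ∈ (s t).net → dst ∉ S.byz →
    ∃ t', (src, pkt) ∈ ((s t').node dst).inbox
  acts : ∀ j, j ∉ S.byz → ∀ a t,
    (∀ t' ≥ t, ∃ ns o, LocalStep S j ((s t').node j) a ns o) → ∃ t' ≥ t, e t' = .act j a

/-- Every sampled committee has a (strict) majority of honest nodes. -/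
def HonestMajority (S : Setup f) : Prop :=
  ∀ i r, S.nc < 2 * (S.committee i r \ S.byz).card

/-- Whenever messages of a sender in rounds `r, …, r + φ` form a chain of certified messages, at least
`f + 1` distinct honest nodes sign at least one of the messages of rounds `r + 1, …, r + φ` in it. -/
def EnoughSigners (S : Setup f) (s : ℕ → State f α) : Prop :=
  ∀ (i : Node f) (r : ℕ) (ch : ℕ → Msg f α), 1 ≤ r →
    (∀ v, r ≤ v → v ≤ r + S.φ →
      (ch v).sender = i ∧ (ch v).round = v ∧ ∃ t, (s t).CertAvailable S (ch v)) →
    (∀ v, r ≤ v → v < r + S.φ → (ch (v + 1)).parent = some (ch v)) →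
    ∃ K : Finset (Node f), f + 1 ≤ K.card ∧
      ∀ k ∈ K, k ∉ S.byz ∧ ∃ v t, r < v ∧ v ≤ r + S.φ ∧ ch v ∈ ((s t).node k).signed

/-- Totality: if an honest node calls `Deliver_i(m, r)`, then every honest node eventually does; the
sender `i` may be honest or Byzantine. -/
def Totality (S : Setup f) (s : ℕ → State f α) : Prop :=
  ∀ (i : Node f) (r : ℕ) (m : Msg f α),
    ∀ p, p ∉ S.byz → ∀ t, ((s t).node p).delivered i r = some m →
      ∀ q, q ∉ S.byz → ∃ t', ((s t').node q).delivered i r = some m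

/-- The event `A` (not required to be measurable itself) holds with probability at least `x`. -/
def HoldsWithProb {Ω : Type*} [MeasurableSpace Ω] (μ : Measure Ω) (x : ℝ) (A : Set Ω) : Prop :=
  ∃ B, MeasurableSet B ∧ B ⊆ A ∧ x ≤ μ.real B

end APMBRB

/-! Totality has a safety half and a liveness half. A Byzantine sender may have several certified
messages for one round, and a node keeps the first message that one of its walks delivers, so the
walks of different nodes must be shown to agree; and whatever started a walk at one honest node must
reach all others.

Safety rests on `Promised`: at least `f + 1` honest nodes hold the message at its place in their
lists of promises. The lists only grow and there are `2f + 1` honest nodes, so two promised messages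
of the same sender and round coincide (`promised_unique`). Everything that a walk may deliver is
promised. Under condition 1 the assumption on signers yields `f + 1` honest nodes that signed a
message above the target on its chain; each had checked the parent against its promises, which
therefore contain the chain down to the target. Under condition 2 at least `f + 1` of the voting
messages have honest senders, and these copied the `prev` entry from their own promises. Hence a
walk at any honest node ends in the delivery of exactly its target (`exists_delivered_of_job`).

Liveness comes from fairness. Messages of honest senders are accepted, synchronised, signed and
certified; so honest nodes send messages in all rounds (`eventually_length_out`), and each of these
is delivered by every honest node, because its sender has a certified message `φ` rounds later
(`eventually_delivered_of_mem_out`).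

The halves combine by induction on time at the delivering node `p`
(`deliveredByAll_of_mem_jobs_or_delivered`). If `p` acted on a certificate, its next own message
carries that certificate or one at least as late, and everyone delivers this message and acts on it.
If `p` saw votes of all `n` nodes, the votes of the honest ones are delivered by everyone and form a
quorum. If `p` used a quorum of delivered messages, these are delivered by everyone by induction. -/

namespace APMBRB

open Filter

variable {f : ℕ} {α : Type*} {S : Setup f}

/-! ### Monotonicity of states -/

/-- The local state `b` is a possible later version of `a`. -/
structure NodeState.Le (a b : NodeState f α) : Prop where
  inbox : a.inbox ⊆ b.inbox
  out : a.out <+: b.out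
  promises : ∀ i, a.promises i <+: b.promises i
  triggers : ∀ i c, a.triggers i = some c → ∃ c', b.triggers i = some c' ∧ c.round ≤ c'.round
  accepted : ∀ i r m, a.accepted i r = some m → b.accepted i r = some m
  signed : a.signed ⊆ b.signed
  jobs : a.jobs ⊆ b.jobs
  delivered : ∀ i r m, a.delivered i r = some m → b.delivered i r = some m

namespace NodeState

theorem Le.refl (a : NodeState f α) : a.Le a where
  inbox := subset_rfl
  out := List.prefix_rfl
  promises _ := List.prefix_rfl
  triggers _ c h := ⟨c, h, le_rfl⟩
  accepted _ _ _ h := h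
  signed := subset_rfl
  jobs := subset_rfl
  delivered _ _ _ h := h

theorem Le.trans {a b c : NodeState f α} (h : a.Le b) (h' : b.Le c) : a.Le c where
  inbox := h.inbox.trans h'.inbox
  out := h.out.trans h'.out
  promises i := (h.promises i).trans (h'.promises i)
  triggers i x hx := by
    obtain ⟨y, hy, hxy⟩ := h.triggers i x hx
    obtain ⟨z, hz, hyz⟩ := h'.triggers i y hy
    exact ⟨z, hz, hxy.trans hyz⟩
  accepted i r m hm := h'.accepted i r m (h.accepted i r m hm)
  signed := h.signed.trans h'.signed
  jobs := h.jobs.trans h'.jobs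
  delivered i r m hm := h'.delivered i r m (h.delivered i r m hm)

theorem Le.holds {a b : NodeState f α} (h : a.Le b) {m : Msg f α} (hm : a.Holds m) :
    b.Holds m := by
  rcases hm with ⟨src, hm⟩ | ⟨src, hm⟩ | hm
  · exact Or.inl ⟨src, h.inbox hm⟩
  · exact Or.inr (Or.inl ⟨src, h.inbox hm⟩)
  · exact Or.inr (Or.inr (h.out.subset hm))

theorem le_deliver (a : NodeState f α) (m : Msg f α) : a.Le (a.deliver m) :=
  { Le.refl a with
    delivered := fun i r x h => by simp [deliver, h] }

theorem le_trigger (a : NodeState f α) (m : Msg f α) : a.Le (a.trigger m) :=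
  { Le.refl a with
    triggers := fun i x h => by
      by_cases hc : i = m.sender ∧ ∀ c₀, a.triggers i = some c₀ → c₀.round < m.round
      · exact ⟨m, by simp only [trigger]; rw [if_pos hc], (hc.2 x h).le⟩
      · exact ⟨x, by simp only [trigger]; rw [if_neg hc, h], le_rfl⟩ }

theorem le_jobs {a b : NodeState f α} (h : a.Le b) (j : Set (ℕ × Msg f α)) (hj : a.jobs ⊆ j) :
    a.Le { b with jobs := j } :=
  { h with jobs := hj }

end NodeState

open NodeState

theorem _root_.List.IsPrefix.getElem?_eq_some {β : Type*} {l l' : List β} (h : l <+: l') {n : ℕ}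
    {x : β} (hx : l[n]? = some x) : l'[n]? = some x := by
  obtain ⟨u, rfl⟩ := h
  have := (List.getElem?_eq_some_iff.1 hx).1
  rw [List.getElem?_append_left this, hx]

theorem LocalStep.le {self : Node f} {a b : NodeState f α} {act : Action f α}
    {o : Set (Node f × Packet f α)} (h : LocalStep S self a act b o) : a.Le b := by
  cases h with
  | sendFirst body m h hm => exact { Le.refl a with out := by simp [h] }
  | sendNext body p m J prev hp hcert hJ hprev hprev0 hm =>
    exact { Le.refl a with out := List.prefix_append _ _ }
  | accept m src hrecv hround hcom hnew =>
    refine { Le.refl a with accepted := fun i r x h => ?_ }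
    have : ¬ (i = m.sender ∧ r = m.round) := by
      rintro ⟨rfl, rfl⟩
      simp [hnew] at h
    simp only
    rw [if_neg this, h]
  | sign m hacc hext => exact { Le.refl a with signed := Set.subset_insert _ _ }
  | askSync i y hy h => exact Le.refl a
  | askReq i y hy h => exact Le.refl a
  | promise m hround hext h =>
    refine { Le.refl a with promises := fun i => ?_ }
    by_cases hi : i = m.sender
    · subst hi; simp
    · simp [Function.update_of_ne hi]
  | answer dst q m hq hm h => exact Le.refl a
  | fetch c h => exact Le.refl a
  | runCert c h hφ => exact le_jobs (le_trigger a c) _ (Set.subset_insert _ _)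
  | advance ns₁ d c h hc h₁ =>
    refine le_jobs ?_ _ Set.subset_union_left
    rcases h₁ with ⟨-, -, rfl⟩ | ⟨-, rfl⟩
    · exact le_deliver a c
    · exact Le.refl _
  | optimistic c M hround hM => exact le_jobs (Le.refl a) _ (Set.subset_insert _ _)
  | quorum c J hround hJ hM => exact le_jobs (Le.refl a) _ (Set.subset_insert _ _)

/-- The global state `s'` is a possible later version of `s`. -/
structure State.Le (s s' : State f α) : Prop where
  node : ∀ k, (s.node k).Le (s'.node k)
  net : s.net ⊆ s'.net

theorem State.Le.refl (s : State f α) : s.Le s := ⟨fun _ => NodeState.Le.refl _, subset_rfl⟩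

theorem State.Le.trans {s s' s'' : State f α} (h : s.Le s') (h' : s'.Le s'') : s.Le s'' :=
  ⟨fun k => (h.node k).trans (h'.node k), h.net.trans h'.net⟩

theorem State.Le.certAvailable {s s' : State f α} (h : s.Le s') {m : Msg f α}
    (hm : s.CertAvailable S m) : s'.CertAvailable S m := by
  obtain ⟨K, hK, hc, hs⟩ := hm
  exact ⟨K, hK, hc, fun k hk => (hs k hk).imp_right fun hx => (h.node k).signed hx⟩

theorem State.Le.authentic {s s' : State f α} (h : s.Le s') {m : Msg f α}
    (hm : s.Authentic S m) : s'.Authentic S m := by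
  unfold State.Authentic at hm ⊢
  split_ifs at hm ⊢
  · exact fun c hc => h.certAvailable (hm c hc)
  · exact (h.node _).out.subset hm

theorem State.Le.derivable {s s' : State f α} (h : s.Le s') {p : Packet f α}
    (hp : s.Derivable S p) : s'.Derivable S p := by
  cases p with
  | propose m => exact h.authentic hp
  | share m k => exact Or.imp_right (fun hx => (h.node k).signed hx) hp
  | cert m => exact h.certAvailable hp
  | askNext i y p w => trivial
  | fetch c => trivial
  | reply m => exact h.authentic hp

theorem Step.le {s s' : State f α} {e : Event f α} (h : Step S s e s') : s.Le s' := by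
  cases h with
  | idle => exact State.Le.refl s
  | recv src dst pkt h =>
    refine ⟨fun k => ?_, subset_rfl⟩
    by_cases hk : k = dst
    · subst hk
      simp only [Function.update_self]
      exact { NodeState.Le.refl _ with inbox := Set.subset_insert _ _ }
    · simp only [Function.update_of_ne hk]
      exact NodeState.Le.refl _
  | act j a ns o hj h =>
    refine ⟨fun k => ?_, Set.subset_union_left⟩
    by_cases hk : k = j
    · subst hk
      simp only [Function.update_self]
      exact h.le
    · simp only [Function.update_of_ne hk]
      exact NodeState.Le.refl _
  | byz src dst pkt hsrc h => exact ⟨fun k => NodeState.Le.refl _, Set.subset_insert _ _⟩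

/-! ### Invariants of reachable states and unforgeability -/

/-- Invariants of the local state of the node `k`. -/
structure LocalInv (S : Setup f) (k : Node f) (ns : NodeState f α) : Prop where
  out : ∀ n m, ns.out[n]? = some m → m.sender = k ∧ m.round = n + 1
  out_parent : ∀ n p m, ns.out[n]? = some p → ns.out[n + 1]? = some m → m.parent = some p
  out_prev : ∀ n m i c, ns.out[n + 1]? = some m → m.prev i = some c →
    (ns.promises i)[n]? = some c
  accepted : ∀ i r m, ns.accepted i r = some m → m.sender = i ∧ m.round = r ∧ 1 ≤ r ∧
    k ∈ S.committee i r ∧ ∃ src, (src, Packet.propose m) ∈ ns.inbox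
  signed : ∀ m ∈ ns.signed, ns.accepted m.sender m.round = some m ∧
    (m.round = 1 ∨ ∃ p, m.parent = some p ∧ (ns.promises m.sender)[m.round - 2]? = some p)
  promises : ∀ i n m, (ns.promises i)[n]? = some m → m.sender = i ∧ m.round = n + 1 ∧ ns.Holds m
  promises_parent : ∀ i n p m, (ns.promises i)[n]? = some p → (ns.promises i)[n + 1]? = some m →
    m.parent = some p
  triggers : ∀ i c, ns.triggers i = some c → c.sender = i ∧ S.φ ≤ c.round
  delivered : ∀ i r m, ns.delivered i r = some m → m.sender = i ∧ m.round = r ∧ ns.Holds m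

theorem LocalInv.start (S : Setup f) (k : Node f) :
    LocalInv S k (NodeState.start : NodeState f α) := by
  constructor <;> simp [NodeState.start]

theorem LocalInv.receive {k : Node f} {ns : NodeState f α} (h : LocalInv S k ns)
    (I : Set (Node f × Packet f α)) (hI : ns.inbox ⊆ I) :
    LocalInv S k { ns with inbox := I } := by
  have hle : ns.Le { ns with inbox := I } := { NodeState.Le.refl _ with inbox := hI }
  exact
    { out := h.out
      out_parent := h.out_parent
      out_prev := h.out_prev
      accepted := fun i r m hm => by
        obtain ⟨h1, h2, h3, h4, src, h5⟩ := h.accepted i r m hm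
        exact ⟨h1, h2, h3, h4, src, hI h5⟩
      signed := h.signed
      promises := fun i n m hm =>
        ⟨(h.promises i n m hm).1, (h.promises i n m hm).2.1, hle.holds (h.promises i n m hm).2.2⟩
      promises_parent := h.promises_parent
      triggers := h.triggers
      delivered := fun i n m hm =>
        ⟨(h.delivered i n m hm).1, (h.delivered i n m hm).2.1,
          hle.holds (h.delivered i n m hm).2.2⟩ }

theorem LocalInv.of_jobs {k : Node f} {ns : NodeState f α} (h : LocalInv S k ns)
    (J : Set (ℕ × Msg f α)) : LocalInv S k { ns with jobs := J } :=
  ⟨h.out, h.out_parent, h.out_prev, h.accepted, h.signed, h.promises, h.promises_parent,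
    h.triggers, h.delivered⟩

theorem _root_.List.getElem?_append_singleton_eq_some {β : Type*} {l : List β} {x y : β} {n : ℕ} :
    (l ++ [x])[n]? = some y ↔ l[n]? = some y ∨ n = l.length ∧ x = y := by
  rcases lt_trichotomy n l.length with h | h | h
  · rw [List.getElem?_append_left h]; simp [h.ne]
  · subst h; simp
  · have h1 : l[n]? = none := List.getElem?_eq_none h.le
    rw [List.getElem?_append_right h.le, h1]
    have : n - l.length ≠ 0 := by omega
    simp [h.ne', this]

theorem LocalStep.localInv {k : Node f} {ns ns' : NodeState f α} {act : Action f α}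
    {o : Set (Node f × Packet f α)} (h : LocalStep S k ns act ns' o) (hi : LocalInv S k ns) :
    LocalInv S k ns' := by
  have hle := h.le
  cases h with
  | sendFirst body m h hm =>
    exact
      { hi with
        out := fun n x hx => by
          have : n = 0 ∧ m = x := by
            simpa using (List.getElem?_append_singleton_eq_some (l := [])).1 hx
          obtain ⟨rfl, rfl⟩ := this
          subst hm; exact ⟨rfl, rfl⟩
        out_parent := fun n p x hp hx => by simp at hx
        out_prev := fun n x i c hx => by simp at hx
        promises := fun i n m hm =>
          ⟨(hi.promises i n m hm).1, (hi.promises i n m hm).2.1,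
            hle.holds (hi.promises i n m hm).2.2⟩
        delivered := fun i n m hm =>
          ⟨(hi.delivered i n m hm).1, (hi.delivered i n m hm).2.1,
            hle.holds (hi.delivered i n m hm).2.2⟩ }
  | sendNext body p m J prev hp hcert hJ hprev hprev0 hm =>
    have hpos : 0 < ns.out.length := by
      rcases List.eq_nil_or_concat ns.out with h | ⟨l, b, h⟩ <;> simp_all
    exact
      { hi with
        out := fun n x hx => by
          rcases List.getElem?_append_singleton_eq_some.1 hx with hx | ⟨rfl, rfl⟩
          · exact hi.out n x hx
          · subst hm; exact ⟨rfl, rfl⟩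
        out_parent := fun n q x hq hx => by
          rcases List.getElem?_append_singleton_eq_some.1 hx with hx | ⟨hn, rfl⟩
          · rcases List.getElem?_append_singleton_eq_some.1 hq with hq | ⟨rfl, rfl⟩
            · exact hi.out_parent n q x hq hx
            · have := (List.getElem?_eq_some_iff.1 hx).1
              omega
          · rcases List.getElem?_append_singleton_eq_some.1 hq with hq | ⟨rfl, rfl⟩
            · rw [List.getLast?_eq_getElem?, ← hn, Nat.add_sub_cancel, hq] at hp
              subst hm
              exact hp.symm
            · omega
        out_prev := fun n x i c hx hc => by
          rcases List.getElem?_append_singleton_eq_some.1 hx with hx | ⟨hn, rfl⟩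
          · exact hi.out_prev n x i c hx hc
          · subst hm
            by_cases hiJ : i ∈ J
            · obtain ⟨c', h1, -, h3⟩ := hprev i hiJ
              have hc : prev i = some c := hc
              rw [hc] at h3
              rw [← hn, Nat.add_sub_cancel] at h1
              rw [h3]; exact h1
            · have hc : prev i = some c := hc
              rw [hprev0 i hiJ] at hc
              cases hc
        promises := fun i n m hm =>
          ⟨(hi.promises i n m hm).1, (hi.promises i n m hm).2.1,
            hle.holds (hi.promises i n m hm).2.2⟩
        delivered := fun i n m hm =>
          ⟨(hi.delivered i n m hm).1, (hi.delivered i n m hm).2.1,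
            hle.holds (hi.delivered i n m hm).2.2⟩ }
  | accept m src hrecv hround hcom hnew =>
    exact
      { hi with
        accepted := fun i r x hx => by
          simp only at hx
          split_ifs at hx with hc
          · obtain ⟨rfl, rfl⟩ := hc
            obtain rfl : m = x := by simpa using hx
            exact ⟨rfl, rfl, hround, hcom, src, hrecv⟩
          · exact hi.accepted i r x hx
        signed := fun x hx =>
          ⟨hle.accepted _ _ _ (hi.signed x hx).1, (hi.signed x hx).2⟩ }
  | sign m hacc hext =>
    exact
      { hi with
        signed := fun x hx => by
          rcases hx with rfl | hx
          · exact ⟨hacc, hext⟩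
          · exact hi.signed x hx }
  | askSync i y hy h => exact hi
  | askReq i y hy h => exact hi
  | promise m hround hext h =>
    have key : ∀ i n x, (Function.update ns.promises m.sender
        (ns.promises m.sender ++ [m]) i)[n]? = some x → (ns.promises i)[n]? = some x ∨
          i = m.sender ∧ n = (ns.promises m.sender).length ∧ m = x := by
      intro i n x hx
      by_cases hi : i = m.sender
      · subst hi
        rw [Function.update_self] at hx
        simpa using List.getElem?_append_singleton_eq_some.1 hx
      · rw [Function.update_of_ne hi] at hx
        exact Or.inl hx
    exact
      { hi with
        out_prev := fun n x i c hx hc =>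
          (hle.promises i).getElem?_eq_some (hi.out_prev n x i c hx hc)
        signed := fun x hx => by
          refine ⟨(hi.signed x hx).1, (hi.signed x hx).2.imp_right ?_⟩
          rintro ⟨p, h1, h2⟩
          exact ⟨p, h1, (hle.promises _).getElem?_eq_some h2⟩
        promises := fun i n x hx => by
          rcases key i n x hx with hx | ⟨rfl, rfl, rfl⟩
          · exact hi.promises i n x hx
          · refine ⟨rfl, hround, ?_⟩
            rcases h with ⟨-, src, -, h⟩ | ⟨-, h, -⟩
            · exact Or.inr (Or.inl ⟨_, h⟩)
            · exact Or.inr (Or.inl ⟨_, h⟩)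
        promises_parent := fun i n p x hp hx => by
          rcases key i n p hp with hp | ⟨rfl, rfl, rfl⟩
          · rcases key i (n + 1) x hx with hx | ⟨rfl, hn, rfl⟩
            · exact hi.promises_parent i n p x hp hx
            · rcases hext with hext | hext
              · simp [hext] at hn
              · rw [hext, List.getLast?_eq_getElem?, ← hn, Nat.add_sub_cancel, hp]
          · rcases key _ _ x hx with hx | ⟨-, hn, -⟩
            · have := (List.getElem?_eq_some_iff.1 hx).1
              omega
            · omega }
  | answer dst q m hq hm h => exact hi
  | fetch c h => exact hi
  | runCert c h hφ =>
    refine LocalInv.of_jobs ?_ _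
    exact
      { hi with
        triggers := fun i x hx => by
          simp only [trigger] at hx
          split_ifs at hx with hc
          · obtain rfl : c = x := by simpa using hx
            exact ⟨hc.1.symm, hφ⟩
          · exact hi.triggers i x hx }
  | advance ns₁ d c h hc h₁ =>
    refine LocalInv.of_jobs ?_ _
    rcases h₁ with ⟨-, -, rfl⟩ | ⟨-, rfl⟩
    · exact
        { hi with
          delivered := fun i r x hx => by
            simp only [deliver] at hx
            split_ifs at hx with hc'
            · obtain rfl : c = x := by simpa using hx
              exact ⟨hc'.1.symm, hc'.2.1.symm, hc⟩
            · exact hi.delivered i r x hx }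
    · exact hi
  | optimistic c M hround hM => exact hi.of_jobs _
  | quorum c J hround hJ hM => exact hi.of_jobs _

/-- What the packets emitted in a local step are justified by. -/
def Packet.Justified (S : Setup f) (k : Node f) (ns : NodeState f α) : Packet f α → Prop
  | .propose m => ns.Holds m
  | .reply m => ns.Holds m
  | .share m l => l = k ∧ m ∈ ns.signed
  | .cert m => ns.HasCert S m
  | .askNext _ _ _ _ => True
  | .fetch _ => True

/-- The justification refers to the state after the step, because a new own message or a new
signature is recorded by the very step that emits it. -/
theorem LocalStep.justified {k : Node f} {ns ns' : NodeState f α} {act : Action f α}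
    {o : Set (Node f × Packet f α)} (h : LocalStep S k ns act ns' o) (hi : LocalInv S k ns)
    {x : Node f × Packet f α} (hx : x ∈ o) : x.2.Justified S k ns' := by
  cases h with
  | sendFirst body m h hm =>
    obtain ⟨-, hx⟩ := hx
    rw [hx]; exact Or.inr (Or.inr (by simp))
  | sendNext body p m J prev hp hcert hJ hprev hprev0 hm =>
    obtain ⟨-, hx⟩ := hx
    rw [hx]; exact Or.inr (Or.inr (by simp))
  | accept m src hrecv hround hcom hnew => exact hx.elim
  | sign m hacc hext =>
    rcases hx with ⟨-, hx⟩ | hx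
    · rw [hx]; exact Or.inl (hi.accepted _ _ _ hacc).2.2.2.2
    · rw [hx]; exact ⟨rfl, Set.mem_insert _ _⟩
  | askSync i y hy h => obtain ⟨-, hx⟩ := hx; rw [hx]; trivial
  | askReq i y hy h => obtain ⟨-, hx⟩ := hx; rw [hx]; trivial
  | promise m hround hext h => exact hx.elim
  | answer dst q m hq hm h =>
    rcases hx with ⟨-, hx | ⟨⟨i, y, p, rfl⟩, hx⟩⟩
    · rw [hx]; exact hm
    · rw [hx]; exact h.2.2.2 rfl
  | fetch c h => obtain ⟨-, hx⟩ := hx; rw [hx]; trivial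
  | runCert c h hφ => exact hx.elim
  | advance ns₁ d c h hc h₁ => exact hx.elim
  | optimistic c M hround hM => exact hx.elim
  | quorum c J hround hJ hM => exact hx.elim

/-- All certificates on which the local state depends satisfy `C`. -/
structure CertInv (C : Msg f α → Prop) (ns : NodeState f α) : Prop where
  out : ∀ m ∈ ns.out, ∀ c, m.Contains c → C c
  triggers : ∀ i c, ns.triggers i = some c → C c
  jobs : ∀ d c, (d, c) ∈ ns.jobs → C c

theorem CertInv.mono {C D : Msg f α → Prop} {ns : NodeState f α} (h : CertInv C ns)
    (hCD : ∀ m, C m → D m) : CertInv D ns :=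
  ⟨fun m hm c hc => hCD c (h.out m hm c hc), fun i c hc => hCD c (h.triggers i c hc),
    fun d c hc => hCD c (h.jobs d c hc)⟩

/-- Every certificate that a node stores was obtained directly or read off a message it holds. The
predicate `C` is left abstract so that it can be availability in the global state after the step,
while the hypotheses speak of the local state before it. -/
theorem LocalStep.certInv {C : Msg f α → Prop} {k : Node f} {ns ns' : NodeState f α}
    {act : Action f α} {o : Set (Node f × Packet f α)} (h : LocalStep S k ns act ns' o)
    (hl : LocalInv S k ns) (hi : CertInv C ns) (hcert : ∀ m, ns.HasCert S m → C m)
    (hholds : ∀ m, ns.Holds m → ∀ c, m.Contains c → C c) : CertInv C ns' := by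
  cases h with
  | sendFirst body m h hm =>
    refine { hi with out := fun x hx c hc => ?_ }
    obtain rfl : x = m := by simpa using hx
    subst hm
    rcases hc with hc | ⟨j, hc⟩ | ⟨j, hc⟩
    · cases hc
    · cases hc
    · exact hi.triggers j c hc
  | sendNext body p m J prev hp hcert' hJ hprev hprev0 hm =>
    refine { hi with out := fun x hx c hc => ?_ }
    have hx : x ∈ ns.out ∨ x = m := by simpa using hx
    rcases hx with hx | rfl
    · exact hi.out x hx c hc
    subst hm
    rcases hc with hc | ⟨j, hc⟩ | ⟨j, hc⟩
    · cases hc; exact hcert _ hcert'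
    · have hc : prev j = some c := hc
      by_cases hj : j ∈ J
      · obtain ⟨c', -, h2, h3⟩ := hprev j hj
        rw [hc] at h3; cases h3
        exact hcert _ h2
      · rw [hprev0 j hj] at hc; cases hc
    · exact hi.triggers j c hc
  | accept m src hrecv hround hcom hnew => exact { hi with }
  | sign m hacc hext => exact { hi with }
  | askSync i y hy h => exact hi
  | askReq i y hy h => exact hi
  | promise m hround hext h => exact { hi with }
  | answer dst q m hq hm h => exact hi
  | fetch c h => exact hi
  | runCert c h hφ =>
    have hc : C c := by
      rcases h with h | ⟨i, r, m, h1, h2⟩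
      · exact hcert _ h
      · exact hholds m (hl.delivered i r m h1).2.2 c (Or.inr (Or.inr ⟨_, h2⟩))
    refine ⟨hi.out, fun i x hx => ?_, fun d x hx => ?_⟩
    · simp only [trigger] at hx
      split_ifs at hx
      · cases hx; exact hc
      · exact hi.triggers i x hx
    · rcases hx with hx | hx
      · cases hx; exact hc
      · exact hi.jobs d x hx
  | advance ns₁ d c h hc h₁ =>
    have h2 : ns₁.out = ns.out ∧ ns₁.triggers = ns.triggers := by
      rcases h₁ with ⟨-, -, rfl⟩ | ⟨-, rfl⟩ <;> exact ⟨rfl, rfl⟩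
    refine ⟨fun m hm => hi.out m (h2.1 ▸ hm), fun i x hx => hi.triggers i x (h2.2 ▸ hx),
      fun d' x hx => ?_⟩
    rcases hx with hx | hx
    · exact hi.jobs d' x hx
    · exact hholds c hc x (Or.inl hx.2.1)
  | optimistic c M hround hM =>
    refine ⟨hi.out, hi.triggers, fun d x hx => ?_⟩
    rcases hx with hx | hx
    · cases hx
      obtain ⟨-, -, -, h1, h2⟩ := hM k
      exact hholds _ h1 c (Or.inr (Or.inl ⟨_, h2⟩))
    · exact hi.jobs d x hx
  | quorum c J hround hJ hM =>
    refine ⟨hi.out, hi.triggers, fun d x hx => ?_⟩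
    rcases hx with hx | hx
    · cases hx
      obtain ⟨j, hj⟩ : J.Nonempty := by
        rw [← Finset.card_pos]; omega
      obtain ⟨m, h1, h2⟩ := hM j hj
      exact hholds _ (hl.delivered _ _ _ h1).2.2 c (Or.inr (Or.inl ⟨_, h2⟩))
    · exact hi.jobs d x hx

/-- Invariants of the global state. -/
structure Inv (S : Setup f) (s : State f α) : Prop where
  loc : ∀ k, LocalInv S k (s.node k)
  net : ∀ src dst pkt, (src, dst, pkt) ∈ s.net → s.Derivable S pkt
  inbox : ∀ k src pkt, (src, pkt) ∈ (s.node k).inbox → (src, k, pkt) ∈ s.net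
  certs : ∀ k, CertInv (s.CertAvailable S) (s.node k)
  byz_out : ∀ k ∈ S.byz, (s.node k).out = []

namespace Inv

variable {s s' : State f α}

theorem certAvailable_of_hasCert (h : Inv S s) {k : Node f} {m : Msg f α}
    (hm : (s.node k).HasCert S m) : s.CertAvailable S m := by
  rcases hm with ⟨K, hK, hc, hs⟩ | hm
  · refine ⟨K, hK, hc, fun l hl => ?_⟩
    obtain ⟨src, hx⟩ := hs l hl
    exact h.net _ _ _ (h.inbox _ _ _ hx)
  · exact h.net _ _ _ (h.inbox _ _ _ hm)

theorem authentic_of_holds (h : Inv S s) {k : Node f} {m : Msg f α}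
    (hm : (s.node k).Holds m) : s.Authentic S m := by
  rcases hm with ⟨src, hm⟩ | ⟨src, hm⟩ | hm
  · exact h.net _ _ _ (h.inbox _ _ _ hm)
  · exact h.net _ _ _ (h.inbox _ _ _ hm)
  · obtain ⟨n, hn⟩ := List.getElem?_of_mem hm
    have hk := ((h.loc k).out n m hn).1
    -- Byzantine nodes perform no local actions, so their `out` stays empty.
    have : m.sender ∉ S.byz := fun hb => by
      have := h.byz_out _ hb
      rw [hk] at this
      simp [this] at hm
    unfold State.Authentic
    rw [if_neg this, hk]
    exact hm

theorem certAvailable_of_contains (h : Inv S s) {m c : Msg f α} (hm : s.Authentic S m)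
    (hc : m.Contains c) : s.CertAvailable S c := by
  unfold State.Authentic at hm
  split_ifs at hm
  · exact hm c hc
  · exact (h.certs _).out m hm c hc

theorem derivable_of_justified (h : Inv S s) {k : Node f} {p : Packet f α}
    (hp : p.Justified S k (s.node k)) : s.Derivable S p := by
  cases p with
  | propose m => exact h.authentic_of_holds hp
  | share m l => exact Or.inr (hp.1 ▸ hp.2)
  | cert m => exact h.certAvailable_of_hasCert hp
  | askNext i y p w => trivial
  | fetch c => trivial
  | reply m => exact h.authentic_of_holds hp

theorem start (S : Setup f) : Inv S (State.start : State f α) where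
  loc k := LocalInv.start S k
  net := by simp [State.start]
  inbox := by simp [State.start, NodeState.start]
  certs k := by constructor <;> simp [State.start, NodeState.start]
  byz_out k _ := rfl

end Inv

theorem LocalStep.inbox_eq {k : Node f} {ns ns' : NodeState f α} {act : Action f α}
    {o : Set (Node f × Packet f α)} (h : LocalStep S k ns act ns' o) : ns'.inbox = ns.inbox := by
  cases h with
  | advance ns₁ d c h hc h₁ => rcases h₁ with ⟨-, -, rfl⟩ | ⟨-, rfl⟩ <;> rfl
  | _ => rfl

theorem Step.inv {s s' : State f α} {e : Event f α} (h : Step S s e s') (hi : Inv S s) :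
    Inv S s' := by
  have hle := h.le
  cases h with
  | idle => exact hi
  | recv src dst pkt h =>
    have hnode : ∀ k, ∃ I, (s.node k).inbox ⊆ I ∧ (∀ x ∈ I, (x.1, k, x.2) ∈ s.net) ∧
        Function.update s.node dst
          { (s.node dst) with inbox := insert (src, pkt) (s.node dst).inbox } k =
          { s.node k with inbox := I } := by
      intro k
      by_cases hk : k = dst
      · subst hk
        refine ⟨_, Set.subset_insert _ _, ?_, Function.update_self ..⟩
        rintro x (rfl | hx)
        · exact h
        · exact hi.inbox _ _ _ hx
      · exact ⟨_, subset_rfl, fun x hx => hi.inbox _ _ _ hx, Function.update_of_ne hk ..⟩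
    refine ⟨fun k => ?_, fun _ _ _ hx => hle.derivable (hi.net _ _ _ hx), fun k x p hx => ?_,
      fun k => ?_, fun k hk => ?_⟩ <;> obtain ⟨I, hI, hI', he⟩ := hnode k
    · simp only [he]; exact (hi.loc k).receive I hI
    · simp only [he] at hx; exact hI' _ hx
    · simp only [he]
      exact ⟨fun m hm c hc => hle.certAvailable ((hi.certs k).out m hm c hc),
        fun i c hc => hle.certAvailable ((hi.certs k).triggers i c hc),
        fun d c hc => hle.certAvailable ((hi.certs k).jobs d c hc)⟩
    · simp only [he]; exact hi.byz_out k hk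
  | act j a ns o hj h =>
    set s' : State f α := { node := Function.update s.node j ns,
                            net := s.net ∪ {x | x.1 = j ∧ x.2 ∈ o} } with hs'
    have hself : s'.node j = ns := Function.update_self ..
    have hne : ∀ k, k ≠ j → s'.node k = s.node k := fun k hk => Function.update_of_ne hk ..
    have hcert : ∀ m, (s.node j).HasCert S m → s'.CertAvailable S m := fun m hm =>
      hle.certAvailable (hi.certAvailable_of_hasCert hm)
    have hloc : ∀ k, LocalInv S k (s'.node k) := by
      intro k
      by_cases hk : k = j
      · subst hk; rw [hself]; exact h.localInv (hi.loc k)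
      · rw [hne k hk]; exact hi.loc k
    have hinbox : ∀ k, (s'.node k).inbox = (s.node k).inbox := by
      intro k
      by_cases hk : k = j
      · subst hk; rw [hself, h.inbox_eq]
      · rw [hne k hk]
    have hcerts : ∀ k, CertInv (s'.CertAvailable S) (s'.node k) := by
      intro k
      by_cases hk : k = j
      · subst hk; rw [hself]
        exact h.certInv (hi.loc k) ((hi.certs k).mono fun m hm => hle.certAvailable hm) hcert
          fun m hm c hc => hle.certAvailable
            (hi.certAvailable_of_contains (hi.authentic_of_holds hm) hc)
      · rw [hne k hk]; exact (hi.certs k).mono fun m hm => hle.certAvailable hm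
    have hbyz : ∀ k ∈ S.byz, (s'.node k).out = [] := fun k hk => by
      rw [hne k (fun hkj => hj (hkj ▸ hk))]; exact hi.byz_out k hk
    have hin : ∀ k src pkt, (src, pkt) ∈ (s'.node k).inbox → (src, k, pkt) ∈ s'.net :=
      fun k src pkt hx => Or.inl (hi.inbox k src pkt (hinbox k ▸ hx))
    refine ⟨hloc, ?_, hin, hcerts, hbyz⟩
    -- the state without the newly emitted packets satisfies the invariant
    have hmid : Inv S { s' with net := s.net } :=
      ⟨hloc, fun src dst pkt hx =>
          (⟨hle.node, subset_rfl⟩ : s.Le { s' with net := s.net }).derivable (hi.net _ _ _ hx),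
        fun k src pkt hx => hi.inbox k src pkt (hinbox k ▸ hx), hcerts, hbyz⟩
    rintro src dst pkt (hx | ⟨-, hx⟩)
    · exact hle.derivable (hi.net _ _ _ hx)
    · have h1 := h.justified (hi.loc j) hx
      rw [← hself] at h1
      exact (⟨fun k => NodeState.Le.refl _, Set.subset_union_left⟩ :
        ({ s' with net := s.net } : State f α).Le s').derivable (hmid.derivable_of_justified h1)
  | byz src dst pkt hsrc h =>
    refine ⟨hi.loc, ?_, fun k x p hx => Or.inr (hi.inbox k x p hx),
      fun k => (hi.certs k).mono fun m hm => hle.certAvailable hm, hi.byz_out⟩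
    rintro x y p (hx | hx)
    · cases hx; exact hle.derivable h
    · exact hle.derivable (hi.net _ _ _ hx)

namespace IsExecution

variable {s : ℕ → State f α} {e : ℕ → Event f α}

theorem inv (h : IsExecution S s e) (t : ℕ) : Inv S (s t) := by
  induction t with
  | zero => rw [h.start]; exact Inv.start S
  | succ t ih => exact (h.step t).inv ih

theorem le (h : IsExecution S s e) {t t' : ℕ} (ht : t ≤ t') : (s t).Le (s t') := by
  induction t', ht using Nat.le_induction with
  | base => exact State.Le.refl _
  | succ t' _ ih => exact ih.trans (h.step t').le

end IsExecution

/-! ### Chains of certificates -/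

/-- `m` lies on the chain of certificates that starts from `c`. -/
abbrev Msg.Reaches (c m : Msg f α) : Prop := Relation.ReflTransGen Msg.Extends c m

theorem Msg.Reaches.sender_eq {c m : Msg f α} (h : c.Reaches m) : m.sender = c.sender := by
  induction h with
  | refl => rfl
  | tail _ h ih => rw [h.2.1, ih]

/-- Indexing the chain by rounds puts it into the form that `EnoughSigners` takes; values outside
the interval of rounds are irrelevant. -/
theorem Msg.Reaches.exists_chain {c m : Msg f α} (h : c.Reaches m) :
    ∃ ch : ℕ → Msg f α, ch m.round = m ∧
      (∀ v, m.round ≤ v → v ≤ c.round →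
        (ch v).round = v ∧ c.Reaches (ch v) ∧ (ch v).Reaches m) ∧
      ∀ v, m.round ≤ v → v < c.round → (ch (v + 1)).Extends (ch v) := by
  induction h with
  | refl =>
    refine ⟨fun _ => c, rfl, fun v h1 h2 => ⟨le_antisymm h1 h2, .refl, .refl⟩, fun v h1 h2 => ?_⟩
    omega
  | @tail b a hb ha ih =>
    obtain ⟨ch, h1, h2, h3⟩ := ih
    have hr := ha.2.2.1
    refine ⟨Function.update ch a.round a, Function.update_self .., fun v hv hv' => ?_,
      fun v hv hv' => ?_⟩
    · rcases hv.eq_or_lt with rfl | hv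
      · rw [Function.update_self]
        exact ⟨rfl, hb.tail ha, .refl⟩
      · rw [Function.update_of_ne hv.ne']
        obtain ⟨h4, h5, h6⟩ := h2 v (by omega) hv'
        exact ⟨h4, h5, h6.tail ha⟩
    · rw [Function.update_of_ne (by omega)]
      rcases hv.eq_or_lt with rfl | hv
      · rw [Function.update_self, hr, h1]; exact ha
      · rw [Function.update_of_ne hv.ne']
        exact h3 v (by omega) hv'

/-- Consecutive promises are linked by parent certificates, and a certificate determines its
message; so one entry fixes all earlier ones. -/
theorem LocalInv.promises_reaches {k : Node f} {ns : NodeState f α} (hi : LocalInv S k ns)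
    {c m : Msg f α} (h : c.Reaches m) (hc : (ns.promises c.sender)[c.round - 1]? = some c) :
    (ns.promises m.sender)[m.round - 1]? = some m := by
  induction h with
  | refl => exact hc
  | @tail b a _ ha ih =>
    obtain ⟨h1, h2, h3, h4⟩ := ha
    have hb : b.round - 1 = (a.round - 1) + 1 := by omega
    rw [hb, ← h2] at ih
    have hlt : a.round - 1 < (ns.promises a.sender).length := by
      have := (List.getElem?_eq_some_iff.1 ih).1
      omega
    have h5 := List.getElem?_eq_getElem hlt
    have h6 := hi.promises_parent _ _ _ _ h5 ih
    rw [h1] at h6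
    exact h5.trans h6.symm

theorem LocalInv.mem_out {k : Node f} {ns : NodeState f α} (hi : LocalInv S k ns) {m : Msg f α}
    (hm : m ∈ ns.out) : m.sender = k ∧ 1 ≤ m.round ∧ ns.out[m.round - 1]? = some m := by
  obtain ⟨n, hn⟩ := List.getElem?_of_mem hm
  obtain ⟨h1, h2⟩ := hi.out n m hn
  refine ⟨h1, by omega, ?_⟩
  rw [h2]; exact hn

/-! ### Safety: walks deliver only promised messages -/

/-- The ways in which a walk along a chain is started. -/
inductive JobOrigin (S : Setup f) (ns ns' : NodeState f α) : ℕ → Msg f α → Prop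
  | cert (c c' : Msg f α) (hφ : S.φ ≤ c.round) (hc' : ns'.triggers c.sender = some c')
      (hround : c.round ≤ c'.round) : JobOrigin S ns ns' (c.round - S.φ) c
  | optimistic (c : Msg f α) (M : Node f → Msg f α) (hround : 1 ≤ c.round)
      (hM : ∀ j, (M j).sender = j ∧ (M j).round = c.round + 1 ∧ ns.Holds (M j) ∧
        (M j).prev c.sender = some c) : JobOrigin S ns ns' c.round c
  | quorum (c : Msg f α) (J : Finset (Node f)) (hround : 1 ≤ c.round) (hJ : J.card = 2 * f + 1)
      (hM : ∀ j ∈ J, ∃ m, ns.delivered j (c.round + 1) = some m ∧ m.prev c.sender = some c) :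
      JobOrigin S ns ns' c.round c

theorem LocalStep.mem_jobs {k : Node f} {ns ns' : NodeState f α} {act : Action f α}
    {o : Set (Node f × Packet f α)} (h : LocalStep S k ns act ns' o) {d : ℕ} {c : Msg f α}
    (hc : (d, c) ∈ ns'.jobs) :
    (d, c) ∈ ns.jobs ∨ (∃ b, (d, b) ∈ ns.jobs ∧ b.Extends c) ∨ JobOrigin S ns ns' d c := by
  cases h with
  | runCert c' h hφ =>
    rcases hc with hc | hc
    · cases hc
      refine Or.inr (Or.inr ?_)
      -- If `c` is not stored, then an entry of at least its round is already there and remains.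
      by_cases hx : ∀ c₀, ns.triggers c.sender = some c₀ → c₀.round < c.round
      · exact .cert c c hφ (if_pos ⟨rfl, hx⟩) le_rfl
      · push Not at hx
        obtain ⟨c₀, h1, h2⟩ := hx
        obtain ⟨c₁, h3, h4⟩ := (le_trigger ns c).triggers _ _ h1
        exact .cert c c₁ hφ h3 (h2.trans h4)
    · exact Or.inl hc
  | advance ns₁ d' b h hb h₁ =>
    rcases hc with hc | ⟨rfl, hc⟩
    · exact Or.inl hc
    · exact Or.inr (Or.inl ⟨b, h, hc⟩)
  | optimistic c' M hround hM =>
    rcases hc with hc | hc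
    · cases hc
      exact Or.inr (Or.inr (.optimistic c M hround fun j =>
        ⟨(hM j).1, (hM j).2.1, (hM j).2.2.2.1, (hM j).2.2.2.2⟩))
    · exact Or.inl hc
  | quorum c' J hround hJ hM =>
    rcases hc with hc | hc
    · cases hc
      exact Or.inr (Or.inr (.quorum c J hround hJ hM))
    · exact Or.inl hc
  | _ => exact Or.inl hc

theorem LocalStep.delivered_eq_some {k : Node f} {ns ns' : NodeState f α} {act : Action f α}
    {o : Set (Node f × Packet f α)} (h : LocalStep S k ns act ns' o) {i : Node f} {r : ℕ}
    {m : Msg f α} (hm : ns'.delivered i r = some m) :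
    ns.delivered i r = some m ∨
      ∃ d, (d, m) ∈ ns.jobs ∧ m.round ≤ d ∧ 1 ≤ m.round ∧ i = m.sender ∧ r = m.round := by
  cases h with
  | advance ns₁ d b h hb h₁ =>
    rcases h₁ with ⟨h1, h2, rfl⟩ | ⟨-, rfl⟩
    · simp only [deliver] at hm
      split_ifs at hm with hc
      · cases hm
        exact Or.inr ⟨d, h, h1, h2, hc.1, hc.2.1⟩
      · exact Or.inl hm
    · exact Or.inl hm
  | _ => exact Or.inl hm

/-- A valid certificate of `m` exists at some time. -/
def Certified (S : Setup f) (s : ℕ → State f α) (m : Msg f α) : Prop :=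
  ∃ t, (s t).CertAvailable S m

/-- Fewer than half of the committee is Byzantine, so the Byzantine members alone cannot make up the
threshold. -/
theorem Certified.exists_signer (hcard : ∀ i r, (S.committee i r).card = S.nc)
    (hmaj : HonestMajority S)
    {s : ℕ → State f α} {m : Msg f α} (hm : Certified S s m) :
    ∃ k ∈ S.committee m.sender m.round, k ∉ S.byz ∧ ∃ t, m ∈ ((s t).node k).signed := by
  obtain ⟨t, K, hK, hKc, hs⟩ := hm
  by_contra! hcon
  have hsub : K ⊆ S.committee m.sender m.round ∩ S.byz := fun k hk => by
    refine Finset.mem_inter.2 ⟨hK hk, ?_⟩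
    by_contra hb
    exact hcon k (hK hk) hb t ((hs k hk).resolve_left hb)
  have h1 := Finset.card_le_card hsub
  have h2 := Finset.card_sdiff_add_card_inter (S.committee m.sender m.round) S.byz
  have h3 := hmaj m.sender m.round
  rw [hcard] at h2
  unfold Setup.threshold at hKc
  omega

/-- `f + 1` honest nodes have `m` in their lists of promises. -/
def Promised (S : Setup f) (s : ℕ → State f α) (m : Msg f α) : Prop :=
  ∃ K : Finset (Node f), f + 1 ≤ K.card ∧ ∀ k ∈ K, k ∉ S.byz ∧
    ∃ t, (((s t).node k).promises m.sender)[m.round - 1]? = some m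

/-- Arrivals and adversarial packets leave jobs, deliveries and own messages untouched; inductions
on time need only consider local steps of the node itself. -/
theorem Step.node_eq_or {s s' : State f α} {e : Event f α} (h : Step S s e s') (k : Node f) :
    ((s'.node k).jobs = (s.node k).jobs ∧ (s'.node k).delivered = (s.node k).delivered ∧
      (s'.node k).out = (s.node k).out) ∨
      k ∉ S.byz ∧ ∃ a o, e = .act k a ∧ LocalStep S k (s.node k) a (s'.node k) o ∧
        ∀ x ∈ o, (k, x) ∈ s'.net := by
  cases h with
  | idle => exact Or.inl ⟨rfl, rfl, rfl⟩
  | recv src dst pkt h =>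
    refine Or.inl ?_
    by_cases hk : k = dst
    · subst hk; simp
    · simp [Function.update_of_ne hk]
  | act j a ns o hj h =>
    by_cases hk : k = j
    · subst hk
      refine Or.inr ⟨hj, a, o, rfl, ?_, fun x hx => Or.inr ⟨rfl, hx⟩⟩
      simpa using h
    · simp [Function.update_of_ne hk]
  | byz src dst pkt hsrc h => exact Or.inl ⟨rfl, rfl, rfl⟩

/-- Disjoint sets would contain `2f + 2` honest nodes, but only `2f + 1` exist. -/
theorem exists_mem_inter_of_card (hbyz : S.byz.card = f) {K L : Finset (Node f)}
    (hK : f + 1 ≤ K.card) (hL : f + 1 ≤ L.card) (hKb : ∀ k ∈ K, k ∉ S.byz)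
    (hLb : ∀ k ∈ L, k ∉ S.byz) : ∃ k ∈ K, k ∈ L := by
  by_contra! hcon
  have hd : Disjoint K L := Finset.disjoint_left.2 hcon
  have hd' : Disjoint (K ∪ L) S.byz := by
    rw [Finset.disjoint_left]
    intro k hk
    rcases Finset.mem_union.1 hk with hk | hk
    · exact hKb k hk
    · exact hLb k hk
  have h1 := Finset.card_le_univ ((K ∪ L) ∪ S.byz)
  rw [Finset.card_union_of_disjoint hd', Finset.card_union_of_disjoint hd, hbyz,
    Fintype.card_fin] at h1
  omega

namespace IsExecution

variable {s : ℕ → State f α} {e : ℕ → Event f α}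

theorem authentic_of_holds (h : IsExecution S s e) {t : ℕ} {k : Node f} {m : Msg f α}
    (hm : ((s t).node k).Holds m) (hb : m.sender ∉ S.byz) :
    m ∈ ((s t).node m.sender).out := by
  have := (h.inv t).authentic_of_holds hm
  unfold State.Authentic at this
  rwa [if_neg hb] at this

theorem certified_of_contains (h : IsExecution S s e) {t : ℕ} {k : Node f} {m c : Msg f α}
    (hm : ((s t).node k).Holds m) (hc : m.Contains c) : Certified S s c :=
  ⟨t, (h.inv t).certAvailable_of_contains ((h.inv t).authentic_of_holds hm) hc⟩

theorem holds_of_signed (h : IsExecution S s e) {t : ℕ} {k : Node f} {m : Msg f α}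
    (hm : m ∈ ((s t).node k).signed) : ((s t).node k).Holds m :=
  Or.inl (((h.inv t).loc k).accepted _ _ _ (((h.inv t).loc k).signed m hm).1).2.2.2.2

/-- A certified message has an honest signer, who holds it; a held message is authentic, so the
certificates inside it are genuine. -/
theorem certified_of_reaches (h : IsExecution S s e)
    (hcard : ∀ i r, (S.committee i r).card = S.nc) (hmaj : HonestMajority S) {c m : Msg f α}
    (hc : Certified S s c) (hm : c.Reaches m) : Certified S s m := by
  induction hm with
  | refl => exact hc
  | tail _ ha ih =>
    obtain ⟨k, -, -, t, ht⟩ := Certified.exists_signer hcard hmaj ih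
    exact h.certified_of_contains (h.holds_of_signed ht) (Or.inl ha.1)

theorem one_le_round (h : IsExecution S s e)
    (hcard : ∀ i r, (S.committee i r).card = S.nc) (hmaj : HonestMajority S) {m : Msg f α}
    (hm : Certified S s m) : 1 ≤ m.round := by
  obtain ⟨k, -, -, t, ht⟩ := Certified.exists_signer hcard hmaj hm
  exact (((h.inv t).loc k).accepted _ _ _ (((h.inv t).loc k).signed m ht).1).2.2.1

/-- An honest signer matched the parent with its own promises, whose entries have the right sender
and round. Thus chains of certified messages do not break off before round 1. -/
theorem exists_extends (h : IsExecution S s e)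
    (hcard : ∀ i r, (S.committee i r).card = S.nc) (hmaj : HonestMajority S) {m : Msg f α}
    (hm : Certified S s m) (hr : m.round ≠ 1) : ∃ p, m.Extends p := by
  have h1 := h.one_le_round hcard hmaj hm
  obtain ⟨k, -, -, t, ht⟩ := Certified.exists_signer hcard hmaj hm
  obtain ⟨p, hp, hp'⟩ := (((h.inv t).loc k).signed m ht).2.resolve_left hr
  obtain ⟨h2, h3, -⟩ := ((h.inv t).loc k).promises _ _ _ hp'
  exact ⟨p, hp, h2, by omega, by omega⟩

theorem exists_reaches (h : IsExecution S s e)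
    (hcard : ∀ i r, (S.committee i r).card = S.nc) (hmaj : HonestMajority S) {c : Msg f α}
    (hc : Certified S s c) {r : ℕ} (hr : 1 ≤ r) (hr' : r ≤ c.round) :
    ∃ m, c.Reaches m ∧ m.round = r := by
  induction hr' using Nat.decreasingInduction with
  | self => exact ⟨c, .refl, rfl⟩
  | of_succ r _ ih =>
    obtain ⟨b, hb, hbr⟩ := ih (by omega)
    obtain ⟨m, hm⟩ := h.exists_extends hcard hmaj (h.certified_of_reaches hcard hmaj hc hb)
      (by omega)
    exact ⟨m, hb.tail hm, by have := hm.2.2.1; omega⟩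

theorem eq_of_promises (h : IsExecution S s e) {k : Node f} {t t' : ℕ} {i : Node f} {n : ℕ}
    {m m' : Msg f α} (hm : (((s t).node k).promises i)[n]? = some m)
    (hm' : (((s t').node k).promises i)[n]? = some m') : m = m' := by
  have h1 := (((h.le (le_max_left t t')).node k).promises i).getElem?_eq_some hm
  have h2 := (((h.le (le_max_right t t')).node k).promises i).getElem?_eq_some hm'
  exact Option.some.inj (h1.symm.trans h2)

theorem promised_unique (h : IsExecution S s e) (hbyz : S.byz.card = f) {m m' : Msg f α}
    (hm : Promised S s m) (hm' : Promised S s m') (hs : m.sender = m'.sender)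
    (hr : m.round = m'.round) : m = m' := by
  obtain ⟨K, hK, hK'⟩ := hm
  obtain ⟨L, hL, hL'⟩ := hm'
  obtain ⟨k, hkK, hkL⟩ := exists_mem_inter_of_card hbyz hK hL (fun k hk => (hK' k hk).1)
    fun k hk => (hL' k hk).1
  obtain ⟨-, t, ht⟩ := hK' k hkK
  obtain ⟨-, t', ht'⟩ := hL' k hkL
  rw [hs, hr] at ht
  exact h.eq_of_promises ht ht'

theorem promised_of_reaches (h : IsExecution S s e)
    (hcard : ∀ i r, (S.committee i r).card = S.nc) (hmaj : HonestMajority S)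
    (hes : EnoughSigners S s) {c m : Msg f α} (hc : Certified S s c) (hm : c.Reaches m)
    (hr : m.round + S.φ ≤ c.round) : Promised S s m := by
  obtain ⟨ch, h1, h2, h3⟩ := hm.exists_chain
  have hpos := h.one_le_round hcard hmaj (h.certified_of_reaches hcard hmaj hc hm)
  obtain ⟨K, hK, hK'⟩ := hes m.sender m.round ch hpos
    (fun v hv hv' => by
      obtain ⟨h4, h5, h6⟩ := h2 v hv (by omega)
      exact ⟨h6.sender_eq.symm, h4, h.certified_of_reaches hcard hmaj hc h5⟩)
    (fun v hv hv' => (h3 v hv (by omega)).1)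
  refine ⟨K, hK, fun k hk => ?_⟩
  obtain ⟨hkb, v, t, hv, hv', hs⟩ := hK' k hk
  refine ⟨hkb, t, ?_⟩
  have hi := (h.inv t).loc k
  obtain ⟨w, rfl⟩ : ∃ w, v = w + 1 := ⟨v - 1, by omega⟩
  obtain ⟨h4, -, h6⟩ := h2 (w + 1) hv.le (by omega)
  obtain ⟨h4', -, h6'⟩ := h2 w (by omega) (by omega)
  have hext := h3 w (by omega) (by omega)
  -- The signed message has round `w + 1 ≥ 2`, so its signer has the parent `ch w` among its
  -- promises, at index `w - 1`, and with it everything down to `m`.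
  obtain ⟨p, hp, hp'⟩ := (hi.signed _ hs).2.resolve_left (by omega)
  rw [hext.1] at hp
  cases hp
  refine hi.promises_reaches h6' ?_
  rw [h4, ← hext.2.1] at hp'
  rw [h4']
  exact hp'

theorem promised_of_votes (h : IsExecution S s e) (hbyz : S.byz.card = f) {t : ℕ} {k : Node f}
    {c m : Msg f α} {J : Finset (Node f)} (hJ : 2 * f + 1 ≤ J.card) (hc : 1 ≤ c.round)
    (hM : ∀ j ∈ J, ∃ v, v.sender = j ∧ v.round = c.round + 1 ∧ ((s t).node k).Holds v ∧
      v.prev c.sender = some c) (hm : c.Reaches m) : Promised S s m := by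
  -- At most `f` of the `2f + 1` voters are Byzantine.
  refine ⟨J \ S.byz, ?_, fun j hj => ?_⟩
  · have := Finset.le_card_sdiff S.byz J
    omega
  · obtain ⟨hj, hjb⟩ := Finset.mem_sdiff.1 hj
    refine ⟨hjb, t, ?_⟩
    obtain ⟨v, rfl, h2, h3, h4⟩ := hM j hj
    have hi := (h.inv t).loc v.sender
    obtain ⟨-, -, h5⟩ := hi.mem_out (h.authentic_of_holds h3 hjb)
    rw [h2, show c.round + 1 - 1 = c.round - 1 + 1 by omega] at h5
    exact hi.promises_reaches hm (hi.out_prev _ _ _ _ h5 h4)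

/-- The claim on jobs covers all targets below the current position of the walk, so it passes on
when the walk moves to a parent; only the start of a walk needs an argument. -/
theorem promised_of_mem_jobs_or_delivered (h : IsExecution S s e) (hbyz : S.byz.card = f)
    (hcard : ∀ i r, (S.committee i r).card = S.nc) (hmaj : HonestMajority S)
    (hes : EnoughSigners S s) (t : ℕ) (k : Node f) :
    (∀ d c, (d, c) ∈ ((s t).node k).jobs → ∀ m, c.Reaches m → m.round ≤ d → Promised S s m) ∧
      ∀ i r m, ((s t).node k).delivered i r = some m → Promised S s m := by
  induction t with
  | zero => simp [h.start, State.start, NodeState.start]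
  | succ t ih =>
    rcases (h.step t).node_eq_or k with ⟨h1, h2, -⟩ | ⟨hk, a, o, -, hstep, -⟩
    · rw [h1, h2]; exact ih
    · refine ⟨fun d c hc m hm hmd => ?_, fun i r m hm => ?_⟩
      · have hcert : Certified S s c := ⟨t + 1, ((h.inv (t + 1)).certs k).jobs d c hc⟩
        rcases hstep.mem_jobs hc with hc | ⟨b, hb, hbc⟩ | ho
        · exact ih.1 d c hc m hm hmd
        · exact ih.1 d b hb m (hm.head hbc) hmd
        · cases ho with
          | cert _ c' hφ hc' hround =>
            exact h.promised_of_reaches hcard hmaj hes hcert hm (by omega)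
          | optimistic _ M hround hM =>
            exact h.promised_of_votes hbyz (J := Finset.univ) (by simp; omega) hround
              (fun j _ => ⟨M j, hM j⟩) hm
          | quorum _ J hround hJ hM =>
            refine h.promised_of_votes hbyz (t := t) (k := k) hJ.ge hround (fun j hj => ?_) hm
            obtain ⟨v, hv, hv'⟩ := hM j hj
            obtain ⟨h3, h4, h5⟩ := ((h.inv t).loc k).delivered _ _ _ hv
            exact ⟨v, h3, h4, h5, hv'⟩
      · rcases hstep.delivered_eq_some hm with hm | ⟨d, hd, h1, -⟩
        · exact ih.2 i r m hm
        · exact ih.1 d m hd m .refl h1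

end IsExecution

/-! ### Effects of the local actions -/

theorem Step.act_inv {s s' : State f α} {j : Node f} {a : Action f α}
    (h : Step S s (.act j a) s') :
    ∃ o, LocalStep S j (s.node j) a (s'.node j) o ∧ ∀ x ∈ o, (j, x) ∈ s'.net := by
  cases h with
  | act _ _ ns o hj h =>
    refine ⟨o, ?_, fun x hx => Or.inr ⟨rfl, hx⟩⟩
    simpa using h

theorem LocalStep.mem_out {k : Node f} {ns ns' : NodeState f α} {act : Action f α}
    {o : Set (Node f × Packet f α)} (h : LocalStep S k ns act ns' o) {m : Msg f α}
    (hm : m ∈ ns'.out) : m ∈ ns.out ∨ m.triggers = ns.triggers ∧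
      ∀ l ∈ S.committee k m.round, (l, .propose m) ∈ o := by
  cases h with
  | sendFirst body x h hx =>
    obtain rfl : m = x := by simpa using hm
    subst hx
    exact Or.inr ⟨rfl, fun l hl => ⟨hl, rfl⟩⟩
  | sendNext body p x J prev hp hcert hJ hprev hprev0 hx =>
    have hm : m ∈ ns.out ∨ m = x := by simpa using hm
    rcases hm with hm | rfl
    · exact Or.inl hm
    · subst hx
      exact Or.inr ⟨rfl, fun l hl => ⟨hl, rfl⟩⟩
  | advance ns₁ d c h hc h₁ =>
    rcases h₁ with ⟨-, -, rfl⟩ | ⟨-, rfl⟩ <;> exact Or.inl hm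
  | _ => exact Or.inl hm

theorem LocalStep.length_out {k : Node f} {ns ns' : NodeState f α}
    {o : Set (Node f × Packet f α)} (h : LocalStep S k ns .send ns' o) :
    ns.out.length < ns'.out.length := by
  cases h <;> simp [*]

theorem LocalStep.accept_inv {k : Node f} {ns ns' : NodeState f α} {m : Msg f α}
    {o : Set (Node f × Packet f α)} (h : LocalStep S k ns (.accept m) ns' o) :
    ns'.accepted m.sender m.round = some m := by
  cases h; exact if_pos ⟨rfl, rfl⟩

theorem LocalStep.sign_inv {k : Node f} {ns ns' : NodeState f α} {m : Msg f α}
    {o : Set (Node f × Packet f α)} (h : LocalStep S k ns (.sign m) ns' o) (l : Node f) :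
    (l, .share m k) ∈ o := by
  cases h; exact Or.inr rfl

theorem LocalStep.askSync_inv {k i : Node f} {ns ns' : NodeState f α}
    {o : Set (Node f × Packet f α)} (h : LocalStep S k ns (.askSync i) ns' o) :
    ∀ l ∈ S.committee i ((ns.promises i).length + 1),
      (l, .askNext i ((ns.promises i).length + 1) (ns.promises i).getLast? false) ∈ o := by
  cases h with
  | askSync _ y hy h => subst hy; exact fun l hl => ⟨hl, rfl⟩

theorem LocalStep.askReq_inv {k i : Node f} {ns ns' : NodeState f α}
    {o : Set (Node f × Packet f α)} (h : LocalStep S k ns (.askReq i) ns' o) :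
    ∃ b, (i, .askNext i ((ns.promises i).length + 1) (ns.promises i).getLast? b) ∈ o := by
  cases h with
  | askReq _ y hy h => subst hy; exact ⟨_, rfl, rfl⟩

theorem LocalStep.promise_inv {k : Node f} {ns ns' : NodeState f α} {m : Msg f α}
    {o : Set (Node f × Packet f α)} (h : LocalStep S k ns (.promise m) ns' o) :
    (ns'.promises m.sender).length = (ns.promises m.sender).length + 1 := by
  cases h; simp

theorem LocalStep.answer_inv {k l : Node f} {q : Packet f α} {ns ns' : NodeState f α}
    {m : Msg f α} {o : Set (Node f × Packet f α)}
    (h : LocalStep S k ns (.answer l q m) ns' o) : (l, .reply m) ∈ o := by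
  cases h; exact ⟨rfl, Or.inl rfl⟩

theorem LocalStep.fetch_inv {k : Node f} {ns ns' : NodeState f α}
    {m : Msg f α} {o : Set (Node f × Packet f α)}
    (h : LocalStep S k ns (.fetch m) ns' o) :
    ∀ l ∈ S.committee m.sender m.round, (l, .fetch m) ∈ o := by
  cases h; exact fun l hl => ⟨hl, rfl⟩

theorem LocalStep.runCert_inv {k : Node f} {ns ns' : NodeState f α}
    {m : Msg f α} {o : Set (Node f × Packet f α)}
    (h : LocalStep S k ns (.runCert m) ns' o) : (m.round - S.φ, m) ∈ ns'.jobs := by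
  cases h; exact Set.mem_insert _ _

theorem LocalStep.quorum_inv {k : Node f} {ns ns' : NodeState f α}
    {m : Msg f α} {o : Set (Node f × Packet f α)}
    (h : LocalStep S k ns (.quorum m) ns' o) : (m.round, m) ∈ ns'.jobs := by
  cases h; exact Set.mem_insert _ _

theorem LocalStep.advance_inv {k : Node f} {ns ns' : NodeState f α} {d : ℕ}
    {c : Msg f α} {o : Set (Node f × Packet f α)} (h : LocalStep S k ns (.advance d c) ns' o) :
    (∀ b, c.Extends b → (d, b) ∈ ns'.jobs) ∧
      (c.round ≤ d → 1 ≤ c.round → ns'.delivered c.sender c.round ≠ none) := by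
  cases h with
  | advance ns₁ _ _ h hc h₁ =>
    refine ⟨fun b hb => Or.inr ⟨rfl, hb⟩, fun h1 h2 => ?_⟩
    rcases h₁ with ⟨-, -, rfl⟩ | ⟨h₁, -⟩
    · by_cases hx : ns.delivered c.sender c.round = none <;> simp [deliver, hx]
    · exact absurd ⟨h1, h2⟩ h₁

theorem LocalInv.out_reaches {k : Node f} {ns : NodeState f α} (hi : LocalInv S k ns)
    {n d : ℕ} {c m : Msg f α} (hm : ns.out[n]? = some m) (hc : ns.out[n + d]? = some c) :
    c.Reaches m := by
  induction d generalizing c with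
  | zero =>
    rw [add_zero, hm] at hc
    cases hc; exact .refl
  | succ d ih =>
    have hlt : n + d < ns.out.length := by
      have := (List.getElem?_eq_some_iff.1 hc).1
      omega
    have hb := List.getElem?_eq_getElem hlt
    obtain ⟨h1, h2⟩ := hi.out _ _ hb
    obtain ⟨h3, h4⟩ := hi.out _ _ hc
    exact (ih hb).head ⟨hi.out_parent _ _ _ hb hc, h1.trans h3.symm, by omega, by omega⟩

theorem HonestMajority.exists_mem (hmaj : HonestMajority S) (i : Node f) (r : ℕ) :
    ∃ k ∈ S.committee i r, k ∉ S.byz := by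
  obtain ⟨k, hk⟩ : (S.committee i r \ S.byz).Nonempty := by
    rw [← Finset.card_pos]
    have := hmaj i r
    omega
  exact ⟨k, (Finset.mem_sdiff.1 hk).1, (Finset.mem_sdiff.1 hk).2⟩

theorem card_honest (hbyz : S.byz.card = f) : (Finset.univ \ S.byz).card = 2 * f + 1 := by
  have := Finset.card_sdiff_add_card_inter Finset.univ S.byz
  rw [Finset.univ_inter, hbyz, Finset.card_univ, Fintype.card_fin] at this
  omega

/-! ### Liveness: messages of honest senders -/

namespace IsExecution

variable {s : ℕ → State f α} {e : ℕ → Event f α}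

theorem eventually_le (h : IsExecution S s e) (t : ℕ) (k : Node f) :
    ∀ᶠ t' in atTop, ((s t).node k).Le ((s t').node k) :=
  eventually_atTop.2 ⟨t, fun _ ht => (h.le ht).node k⟩

theorem eventually_received (h : IsExecution S s e) {t : ℕ} {src dst : Node f} {p : Packet f α}
    (hp : (src, dst, p) ∈ (s t).net) (hd : dst ∉ S.byz) :
    ∀ᶠ t' in atTop, (src, p) ∈ ((s t').node dst).inbox := by
  obtain ⟨t', ht'⟩ := h.arrives t src dst p hp hd
  exact (h.eventually_le t' dst).mono fun _ hle => hle.inbox ht'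

/-- The form in which fairness is used: an action that is enabled from some time on occurs at a
moment when any given eventual property `P` holds, and its packets to honest nodes arrive. -/
theorem fair (h : IsExecution S s e) {j : Node f} (hj : j ∉ S.byz) {a : Action f α}
    {P : ℕ → Prop} (hP : ∀ᶠ t in atTop, P t)
    (ha : ∀ᶠ t in atTop, ∃ ns o, LocalStep S j ((s t).node j) a ns o) :
    ∃ t o, P t ∧ LocalStep S j ((s t).node j) a ((s (t + 1)).node j) o ∧
      ∀ l p, (l, p) ∈ o → l ∉ S.byz → ∀ᶠ t' in atTop, (j, p) ∈ ((s t').node l).inbox := by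
  obtain ⟨T, hT⟩ := eventually_atTop.1 (hP.and ha)
  obtain ⟨t, ht, he⟩ := h.acts j hj a T fun t ht => (hT t ht).2
  have hstep := h.step t
  rw [he] at hstep
  obtain ⟨o, ho, hnet⟩ := hstep.act_inv
  exact ⟨t, o, (hT t ht).1, ho, fun l p hlp hl => h.eventually_received (hnet _ hlp) hl⟩

theorem eventually_reply (h : IsExecution S s e) {j k : Node f} (hj : j ∉ S.byz) (hk : k ∉ S.byz)
    {q : Packet f α} {m : Msg f α} (hq : ∀ᶠ t in atTop, (k, q) ∈ ((s t).node j).inbox)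
    (hm : ∀ᶠ t in atTop, ((s t).node j).Holds m)
    (ha : ∀ᶠ t in atTop, ((s t).node j).Answers S q m) :
    ∀ᶠ t in atTop, (j, .reply m) ∈ ((s t).node k).inbox := by
  obtain ⟨t, o, -, hs, ho⟩ := h.fair hj (a := .answer k q m) (eventually_true _) <| by
    filter_upwards [hq, hm, ha] with t h1 h2 h3
    exact ⟨_, _, .answer _ _ _ _ h1 h2 h3⟩
  exact ho _ _ hs.answer_inv hk

theorem propose_mem_net (h : IsExecution S s e) {t : ℕ} {j k : Node f} {m : Msg f α}
    (hm : m ∈ ((s t).node j).out) (hk : k ∈ S.committee j m.round) :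
    (j, k, .propose m) ∈ (s t).net := by
  induction t with
  | zero => simp [h.start, State.start, NodeState.start] at hm
  | succ t ih =>
    have hle := (h.step t).le
    rcases (h.step t).node_eq_or j with ⟨-, -, h1⟩ | ⟨-, a, o, -, hs, ho⟩
    · exact hle.net (ih (h1 ▸ hm))
    · rcases hs.mem_out hm with hm | ⟨-, hm⟩
      · exact hle.net (ih hm)
      · exact ho _ (hm k hk)

theorem exists_triggers_eq (h : IsExecution S s e) {t t' : ℕ} (ht : t ≤ t') {j : Node f}
    {m : Msg f α} (hm : m ∈ ((s t').node j).out) (hm' : m ∉ ((s t).node j).out) :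
    ∃ u, t ≤ u ∧ m.triggers = ((s u).node j).triggers := by
  induction t', ht using Nat.le_induction with
  | base => exact absurd hm hm'
  | succ t' ht ih =>
    rcases (h.step t').node_eq_or j with ⟨-, -, h1⟩ | ⟨-, a, o, -, hs, ho⟩
    · exact ih (h1 ▸ hm)
    · rcases hs.mem_out hm with hm | ⟨hm, -⟩
      · exact ih hm
      · exact ⟨t', ht, hm⟩

theorem out_unique (h : IsExecution S s e) {t t' : ℕ} {j : Node f} {m m' : Msg f α}
    (hm : m ∈ ((s t).node j).out) (hm' : m' ∈ ((s t').node j).out) (hr : m.round = m'.round) :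
    m = m' := by
  have h1 := (((h.le (le_max_left t t')).node j).out).getElem?_eq_some
    (((h.inv t).loc j).mem_out hm).2.2
  have h2 := (((h.le (le_max_right t t')).node j).out).getElem?_eq_some
    (((h.inv t').loc j).mem_out hm').2.2
  rw [hr, h2] at h1
  exact (Option.some.inj h1).symm

theorem eventually_holds_of_mem_out (h : IsExecution S s e) {t : ℕ} {j k : Node f} {m : Msg f α}
    (hm : m ∈ ((s t).node j).out) (hk : k ∈ S.committee j m.round) (hkb : k ∉ S.byz) :
    ∀ᶠ t' in atTop, ((s t').node k).Holds m :=
  (h.eventually_received (h.propose_mem_net hm hk) hkb).mono fun _ hx => Or.inl ⟨_, hx⟩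

theorem eventually_accepted (h : IsExecution S s e) {t : ℕ} {j k : Node f} {m : Msg f α}
    (hj : j ∉ S.byz) (hm : m ∈ ((s t).node j).out) (hk : k ∈ S.committee j m.round)
    (hkb : k ∉ S.byz) : ∀ᶠ t' in atTop, ((s t').node k).accepted j m.round = some m := by
  by_contra hcon
  obtain ⟨rfl, hr, -⟩ := ((h.inv t).loc j).mem_out hm
  -- An honest sender has one message per round, so the slot can only be filled by `m`; if `m` is
  -- never accepted, the slot stays empty and acceptance stays enabled.
  have hnone : ∀ t', ((s t').node k).accepted m.sender m.round = none := by
    intro t'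
    by_contra hx
    obtain ⟨x, hx⟩ := Option.ne_none_iff_exists'.1 hx
    obtain ⟨h1, h2, -, -, h3⟩ := ((h.inv t').loc k).accepted _ _ _ hx
    have h4 := h.authentic_of_holds (Or.inl h3) (h1 ▸ hj)
    rw [h1] at h4
    obtain rfl := h.out_unique hm h4 h2.symm
    exact hcon ((h.eventually_le t' k).mono fun _ hle => hle.accepted _ _ _ hx)
  obtain ⟨t', o, -, hs, -⟩ := h.fair hkb (a := .accept m) (eventually_true _) <| by
    filter_upwards [h.eventually_received (h.propose_mem_net hm hk) hkb] with t' ht'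
    exact ⟨_, _, .accept _ m _ ht' hr hk (hnone t')⟩
  have := hs.accept_inv
  rw [hnone] at this
  cases this

theorem promises_eq_out (h : IsExecution S s e) {t t' : ℕ} {j k : Node f} {m x : Msg f α}
    {n : ℕ} (hj : j ∉ S.byz) (hm : ((s t).node j).out[n]? = some m)
    (hx : (((s t').node k).promises j)[n]? = some x) : x = m := by
  obtain ⟨h1, h2, h3⟩ := ((h.inv t').loc k).promises _ _ _ hx
  have h4 := h.authentic_of_holds h3 (h1 ▸ hj)
  rw [h1] at h4
  exact h.out_unique h4 (List.mem_of_getElem? hm)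
    (h2.trans (((h.inv t).loc j).out _ _ hm).2.symm)

/-- For an honest sender the promises held anywhere agree with its own messages, so its next message
passes the linking test. -/
theorem promises_eq_nil_or_parent (h : IsExecution S s e) {t t' : ℕ} {j k : Node f} {m : Msg f α}
    (hj : j ∉ S.byz)
    (hm : ((s t).node j).out[(((s t').node k).promises j).length]? = some m) :
    ((s t').node k).promises j = [] ∨
      m.parent = (((s t').node k).promises j).getLast? := by
  rcases hl : (((s t').node k).promises j).length with _ | n
  · exact Or.inl (List.length_eq_zero_iff.1 hl)
  · refine Or.inr ?_
    rw [hl] at hm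
    have hlt : n < ((s t).node j).out.length := by
      have := (List.getElem?_eq_some_iff.1 hm).1
      omega
    have h1 := List.getElem?_eq_getElem hlt
    have hlt' : n < (((s t').node k).promises j).length := by omega
    have h2 := List.getElem?_eq_getElem hlt'
    have h3 := h.promises_eq_out hj h1 h2
    rw [List.getLast?_eq_getElem?, hl, Nat.add_sub_cancel, h2, h3]
    exact ((h.inv t).loc j).out_parent _ _ _ h1 hm

/-- Shared induction step of `syncMsg` and `reqMsg`. The list may grow by itself; hence a usable
reply is required only when the length remains `n` forever, which keeps the pending request the
right one. -/
theorem eventually_length_promises_succ (h : IsExecution S s e) {t n : ℕ} {j k : Node f}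
    {m : Msg f α} (hj : j ∉ S.byz) (hk : k ∉ S.byz) (hm : ((s t).node j).out[n]? = some m)
    (hn : ∀ᶠ t' in atTop, n ≤ (((s t').node k).promises j).length)
    (hp : (∀ᶠ t' in atTop, (((s t').node k).promises j).length = n) → ∀ᶠ t' in atTop,
      (((s t').node k).Syncing j (n + 1) ∧
        ∃ src ∈ S.committee j (n + 1), (src, .reply m) ∈ ((s t').node k).inbox) ∨
      (n + 1 ≤ ((s t').node k).out.length ∧ (j, .reply m) ∈ ((s t').node k).inbox ∧
        ((s t').node k).HasCert S m)) :
    ∀ᶠ t' in atTop, n + 1 ≤ (((s t').node k).promises j).length := by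
  by_contra hcon
  have hlt : ∀ t', (((s t').node k).promises j).length < n + 1 := by
    intro t'
    by_contra! hx
    exact hcon ((h.eventually_le t' k).mono fun _ hle => hx.trans (hle.promises j).length_le)
  have heq : ∀ᶠ t' in atTop, (((s t').node k).promises j).length = n := by
    filter_upwards [hn] with t' ht'
    have := hlt t'
    omega
  obtain ⟨rfl, hr⟩ := ((h.inv t).loc j).out _ _ hm
  obtain ⟨t', o, h1, hs, -⟩ := h.fair hk (a := .promise m) heq <| by
    filter_upwards [heq, hp heq] with t' h1 h2
    refine ⟨_, _, .promise _ m (by rw [hr, h1]) ?_ ?_⟩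
    · exact h.promises_eq_nil_or_parent (t := t) hj (by rw [h1]; exact hm)
    · rw [hr]
      exact h2.imp_right fun h3 => ⟨h3.1, h3.2.1, fun _ => h3.2.2⟩
  have h2 := hs.promise_inv
  have h3 := hlt (t' + 1)
  omega

theorem answers_askNext (h : IsExecution S s e) {t t' t'' : ℕ} {j k l : Node f} {m : Msg f α}
    {n : ℕ} {b : Bool} (hj : j ∉ S.byz) (hm : ((s t).node j).out[n]? = some m)
    (hn : (((s t').node k).promises j).length = n)
    (hc : b = true → ((s t'').node l).HasCert S m) :
    ((s t'').node l).Answers S (.askNext j ((((s t').node k).promises j).length + 1)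
      (((s t').node k).promises j).getLast? b) m := by
  obtain ⟨h1, h2⟩ := ((h.inv t).loc j).out _ _ hm
  refine ⟨h1, by omega, ?_, hc⟩
  exact (h.promises_eq_nil_or_parent (t := t) hj (by rw [hn]; exact hm)).imp_left
    fun hx => by rw [hx]; rfl

theorem eventually_synced (h : IsExecution S s e) (hmaj : HonestMajority S) {t : ℕ}
    {j k : Node f} {m : Msg f α} (hj : j ∉ S.byz) (hm : m ∈ ((s t).node j).out)
    (hk : k ∈ S.committee j m.round) (hkb : k ∉ S.byz) {n : ℕ} (hn : n < m.round) :
    ∀ᶠ t' in atTop, n ≤ (((s t').node k).promises j).length := by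
  induction n with
  | zero => exact .of_forall fun _ => Nat.zero_le _
  | succ n ih =>
    have hlt : n < ((s t).node j).out.length := by
      have := (List.getElem?_eq_some_iff.1 (((h.inv t).loc j).mem_out hm).2.2).1
      omega
    have hx := List.getElem?_eq_getElem hlt
    set x := ((s t).node j).out[n]
    refine h.eventually_length_promises_succ hj hkb hx (ih (by omega)) fun heq => ?_
    have hsync : ∀ᶠ t' in atTop, ((s t').node k).Syncing j (n + 1) := by
      filter_upwards [h.eventually_accepted hj hm hk hkb] with t' ht'
      exact ⟨m.round, hn, by simp [ht']⟩
    obtain ⟨t', o, h1, hs, ho⟩ := h.fair hkb (a := .askSync j) heq <| by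
      filter_upwards [heq, hsync] with t' h1 h2
      exact ⟨_, _, .askSync _ j (n + 1) (by rw [h1]) h2⟩
    -- An honest committee member received `x` from its honest sender and can answer.
    obtain ⟨l, hl, hlb⟩ := hmaj.exists_mem j (n + 1)
    have hxr := ((h.inv t).loc j).out _ _ hx
    have hrep := h.eventually_reply hlb hkb (m := x)
      (ho l _ (hs.askSync_inv l (by rw [h1]; exact hl)) hlb)
      (h.eventually_holds_of_mem_out (List.mem_of_getElem? hx) (by rw [hxr.2]; exact hl) hlb)
      (.of_forall fun _ => h.answers_askNext hj hx h1 fun hb => by cases hb)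
    filter_upwards [hsync, hrep] with t' h1 h2
    exact Or.inl ⟨h1, l, hl, h2⟩

theorem eventually_share (h : IsExecution S s e) (hmaj : HonestMajority S) {t : ℕ}
    {j k q : Node f} {m : Msg f α} (hj : j ∉ S.byz) (hm : m ∈ ((s t).node j).out)
    (hk : k ∈ S.committee j m.round) (hkb : k ∉ S.byz) (hq : q ∉ S.byz) :
    ∀ᶠ t' in atTop, (k, .share m k) ∈ ((s t').node q).inbox := by
  obtain ⟨hmj, hr, hget⟩ := ((h.inv t).loc j).mem_out hm
  obtain ⟨t', o, -, hs, ho⟩ := h.fair hkb (a := .sign m) (eventually_true _) <| by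
    filter_upwards [h.eventually_accepted hj hm hk hkb,
      h.eventually_synced hmaj hj hm hk hkb (n := m.round - 1) (by omega)] with t' h1 h2
    refine ⟨_, _, .sign _ m (by rw [hmj]; exact h1) ?_⟩
    rcases hr.eq_or_lt with hr | hr
    · exact Or.inl hr.symm
    · refine Or.inr ?_
      have hlt : m.round - 2 < (((s t').node k).promises j).length := by omega
      have hlt' : m.round - 2 < ((s t).node j).out.length := by
        have := (List.getElem?_eq_some_iff.1 hget).1
        omega
      have h3 := List.getElem?_eq_getElem hlt
      have h4 := List.getElem?_eq_getElem hlt'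
      have h5 := h.promises_eq_out hj h4 h3
      rw [show m.round - 1 = m.round - 2 + 1 by omega] at hget
      refine ⟨_, ((h.inv t).loc j).out_parent _ _ _ h4 hget, ?_⟩
      rw [hmj, h3, h5]
  exact ho _ _ (hs.sign_inv q) hq

/-- The honest members of the committee alone reach the threshold, and all of them sign a message of
an honest sender. -/
theorem eventually_hasCert (h : IsExecution S s e) (hmaj : HonestMajority S) {t : ℕ}
    {j q : Node f} {m : Msg f α} (hj : j ∉ S.byz) (hm : m ∈ ((s t).node j).out) (hq : q ∉ S.byz) :
    ∀ᶠ t' in atTop, ((s t').node q).HasCert S m := by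
  obtain ⟨hmj, -⟩ := ((h.inv t).loc j).mem_out hm
  have hall : ∀ᶠ t' in atTop, ∀ k ∈ S.committee j m.round \ S.byz,
      (k, Packet.share m k) ∈ ((s t').node q).inbox :=
    (Finset.eventually_all _).2 fun k hk =>
      h.eventually_share hmaj hj hm (Finset.mem_sdiff.1 hk).1 (Finset.mem_sdiff.1 hk).2 hq
  filter_upwards [hall] with t' ht'
  refine Or.inl ⟨S.committee j m.round \ S.byz, ?_, ?_, fun k hk => ⟨k, ht' k hk⟩⟩
  · rw [hmj]; exact Finset.sdiff_subset
  · have := hmaj j m.round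
    unfold Setup.threshold
    omega

theorem eventually_requested (h : IsExecution S s e) (hmaj : HonestMajority S) {r n : ℕ}
    {j k : Node f} (hj : j ∉ S.byz) (hk : k ∉ S.byz)
    (hjr : ∀ᶠ t in atTop, r ≤ ((s t).node j).out.length)
    (hkr : ∀ᶠ t in atTop, r ≤ ((s t).node k).out.length) (hn : n ≤ r) :
    ∀ᶠ t in atTop, n ≤ (((s t).node k).promises j).length := by
  induction n with
  | zero => exact .of_forall fun _ => Nat.zero_le _
  | succ n ih =>
    obtain ⟨t, ht⟩ := hjr.exists
    have hlt : n < ((s t).node j).out.length := by omega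
    have hx := List.getElem?_eq_getElem hlt
    set x := ((s t).node j).out[n]
    have hxm := List.mem_of_getElem? hx
    refine h.eventually_length_promises_succ hj hk hx (ih (by omega)) fun heq => ?_
    obtain ⟨t', o, h1, hs, ho⟩ := h.fair hk (a := .askReq j) heq <| by
      filter_upwards [heq, hkr] with t' h1 h2
      exact ⟨_, _, .askReq _ j (n + 1) (by rw [h1]) (by omega)⟩
    -- The flag `b` depends on how far `k` has come when it asks; either kind of request can be
    -- answered, as `j` eventually has the certificate.
    obtain ⟨b, hb⟩ := hs.askReq_inv
    have hrep := h.eventually_reply hj hk (m := x) (ho j _ hb hj)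
      ((h.eventually_le t j).mono fun _ hle => Or.inr (Or.inr (hle.out.subset hxm)))
      ((h.eventually_hasCert hmaj hj hxm hj).mono fun _ hc =>
        h.answers_askNext hj hx h1 fun _ => hc)
    filter_upwards [hkr, hrep, h.eventually_hasCert hmaj hj hxm hk] with t' h1 h2 h3
    exact Or.inr ⟨by omega, h2, h3⟩

theorem eventually_length_out [Nonempty α] (h : IsExecution S s e) (hbyz : S.byz.card = f)
    (hmaj : HonestMajority S) (r : ℕ) {k : Node f} (hk : k ∉ S.byz) :
    ∀ᶠ t in atTop, r ≤ ((s t).node k).out.length := by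
  induction r generalizing k with
  | zero => exact .of_forall fun _ => Nat.zero_le _
  | succ r ih =>
    by_contra hcon
    have hlt : ∀ t, ((s t).node k).out.length < r + 1 := by
      intro t
      by_contra! hx
      exact hcon ((h.eventually_le t k).mono fun _ hle => hx.trans hle.out.length_le)
    have heq : ∀ᶠ t in atTop, ((s t).node k).out.length = r := by
      filter_upwards [ih hk] with t ht
      have := hlt t
      omega
    obtain ⟨body⟩ := ‹Nonempty α›
    obtain ⟨t, o, h1, hs, -⟩ := h.fair hk (a := .send) heq <| by
      rcases r with _ | n
      · filter_upwards [heq] with t ht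
        exact ⟨_, _, .sendFirst _ body _ (List.length_eq_zero_iff.1 ht) rfl⟩
      -- The honest nodes, exactly `2f + 1` in number, serve as `J`; by induction all of them have
      -- sent a message of round `n + 1`.
      have hJ : ∀ᶠ t in atTop, ∀ j ∈ Finset.univ \ S.byz, ∃ c,
          (((s t).node k).promises j)[n]? = some c ∧ ((s t).node k).HasCert S c := by
        refine (Finset.eventually_all _).2 fun j hj => ?_
        have hj := (Finset.mem_sdiff.1 hj).2
        obtain ⟨t, ht⟩ := (ih hj).exists
        have hx := List.getElem?_eq_getElem (show n < ((s t).node j).out.length by omega)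
        filter_upwards [h.eventually_requested hmaj hj hk (ih hj) (ih hk) le_rfl,
          h.eventually_hasCert hmaj hj (List.mem_of_getElem? hx) hk] with t' h1 h2
        have h3 := List.getElem?_eq_getElem
          (show n < (((s t').node k).promises j).length by omega)
        exact ⟨_, h3, h.promises_eq_out hj hx h3 ▸ h2⟩
      obtain ⟨t, ht⟩ := heq.exists
      have hp := List.getElem?_eq_getElem (show n < ((s t).node k).out.length by omega)
      filter_upwards [heq, hJ, h.eventually_le t k,
        h.eventually_hasCert hmaj hk (List.mem_of_getElem? hp) hk] with t' h1 h2 h3 h4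
      have : Nonempty (Msg f α) :=
        ⟨.mk body k 0 none (fun _ => none) fun _ => none⟩
      choose! c hc hc' using h2
      classical
      refine ⟨_, _, .sendNext _ body _ _ (Finset.univ \ S.byz)
        (fun j => if j ∈ Finset.univ \ S.byz then some (c j) else none) ?_ h4
        (card_honest hbyz) (fun j hj => ⟨c j, ?_, hc' j hj, if_pos hj⟩)
        (fun j hj => if_neg hj) rfl⟩
      · rw [List.getLast?_eq_getElem?, h1, Nat.add_sub_cancel]
        exact h3.out.getElem?_eq_some hp
      · rw [h1, Nat.add_sub_cancel]
        exact hc j hj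
    have h2 := hs.length_out
    have h3 := hlt (t + 1)
    omega

/-! ### Liveness: completion of walks -/

theorem eventually_job_of_reaches (h : IsExecution S s e)
    (hcard : ∀ i r, (S.committee i r).card = S.nc) (hmaj : HonestMajority S) {t d : ℕ}
    {q : Node f} (hq : q ∉ S.byz) {c m : Msg f α} (hc : (d, c) ∈ ((s t).node q).jobs)
    (hm : c.Reaches m) :
    ∃ t, (d, m) ∈ ((s t).node q).jobs ∧
      (m.round ≤ d → ((s t).node q).delivered m.sender m.round ≠ none) := by
  -- One iteration of the walk: an honest signer of `b` in its committee holds `b` and answers the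
  -- fetch, after which the iteration is enabled forever.
  have key : ∀ {t : ℕ} {b : Msg f α}, (d, b) ∈ ((s t).node q).jobs →
      ∃ t', (d, b) ∈ ((s t').node q).jobs ∧ (∀ a, b.Extends a → (d, a) ∈ ((s t').node q).jobs) ∧
        (b.round ≤ d → ((s t').node q).delivered b.sender b.round ≠ none) := by
    intro t b hb
    have hcert : Certified S s b := ⟨t, ((h.inv t).certs q).jobs d b hb⟩
    have hjob : ∀ᶠ t' in atTop, (d, b) ∈ ((s t').node q).jobs :=
      (h.eventually_le t q).mono fun _ hle => hle.jobs hb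
    obtain ⟨k, hk, hkb, t₁, ht₁⟩ := Certified.exists_signer hcard hmaj hcert
    obtain ⟨t₂, o, -, hs, ho⟩ := h.fair hq (a := .fetch b) (eventually_true _) <| by
      filter_upwards [hjob] with t' ht'
      exact ⟨_, _, .fetch _ b (Or.inr ⟨d, ht'⟩)⟩
    have hrep := h.eventually_reply hkb hq (m := b) (ho k _ (hs.fetch_inv k hk) hkb)
      ((h.eventually_le t₁ k).mono fun _ hle => hle.holds (h.holds_of_signed ht₁))
      (.of_forall fun _ => rfl)
    obtain ⟨t₃, o', h1, hs', -⟩ := h.fair hq (a := .advance d b) hjob <| by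
      filter_upwards [hjob, hrep] with t' h1 h2
      by_cases hd : b.round ≤ d ∧ 1 ≤ b.round
      · exact ⟨_, _, .advance _ _ d b h1 (Or.inr (Or.inl ⟨k, h2⟩)) (Or.inl ⟨hd.1, hd.2, rfl⟩)⟩
      · exact ⟨_, _, .advance _ _ d b h1 (Or.inr (Or.inl ⟨k, h2⟩)) (Or.inr ⟨hd, rfl⟩)⟩
    exact ⟨t₃ + 1, ((h.step t₃).le.node q).jobs h1, hs'.advance_inv.1,
      fun hd => hs'.advance_inv.2 hd (h.one_le_round hcard hmaj hcert)⟩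
  obtain ⟨t, ht⟩ : ∃ t, (d, m) ∈ ((s t).node q).jobs := by
    induction hm with
    | refl => exact ⟨t, hc⟩
    | tail _ ha ih =>
      obtain ⟨t, ht⟩ := ih
      obtain ⟨t', -, h1, -⟩ := key ht
      exact ⟨t', h1 _ ha⟩
  obtain ⟨t', h1, -, h2⟩ := key ht
  exact ⟨t', h1, h2⟩

theorem eventually_delivered_of_mem_out [Nonempty α] (h : IsExecution S s e)
    (hbyz : S.byz.card = f) (hcard : ∀ i r, (S.committee i r).card = S.nc)
    (hmaj : HonestMajority S) {t : ℕ} {j q : Node f} {m : Msg f α} (hj : j ∉ S.byz)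
    (hm : m ∈ ((s t).node j).out) (hq : q ∉ S.byz) :
    ∃ t', ((s t').node q).delivered j m.round = some m := by
  obtain ⟨hmj, hr, hget⟩ := ((h.inv t).loc j).mem_out hm
  obtain ⟨t₁, ht₁, hle⟩ := ((h.eventually_length_out hbyz hmaj (m.round + S.φ) hj).and
    (h.eventually_le t j)).exists
  -- The message `c` of round `m.round + φ` starts a walk that delivers exactly from round `m.round`
  -- downwards.
  have hlt : m.round - 1 + S.φ < ((s t₁).node j).out.length := by omega
  have hc := List.getElem?_eq_getElem hlt
  set c := ((s t₁).node j).out[m.round - 1 + S.φ]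
  have hi := (h.inv t₁).loc j
  have hcr := (hi.out _ _ hc).2
  have hreach := hi.out_reaches (hle.out.getElem?_eq_some hget) hc
  obtain ⟨t₂, o, -, hs, -⟩ := h.fair hq (a := .runCert c) (eventually_true _) <| by
    filter_upwards [h.eventually_hasCert hmaj hj (List.mem_of_getElem? hc) hq] with t' ht'
    exact ⟨_, _, .runCert _ c (Or.inl ht') (by omega)⟩
  obtain ⟨t₃, -, h3⟩ := h.eventually_job_of_reaches hcard hmaj hq hs.runCert_inv hreach
  obtain ⟨x, hx⟩ := Option.ne_none_iff_exists'.1 (h3 (by omega))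
  obtain ⟨h4, h5, h6⟩ := ((h.inv t₃).loc q).delivered _ _ _ hx
  rw [hmj] at h4 hx
  have h7 := h.authentic_of_holds h6 (h4 ▸ hj)
  rw [h4] at h7
  -- No promises are needed here: an honest sender has only one message for this round.
  obtain rfl := h.out_unique hm h7 h5.symm
  exact ⟨t₃, hx⟩

end IsExecution

/-! ### Totality of an execution -/

/-- Every honest node eventually delivers `m`. -/
def DeliveredByAll (S : Setup f) (s : ℕ → State f α) (m : Msg f α) : Prop :=
  ∀ q, q ∉ S.byz → ∃ t, ((s t).node q).delivered m.sender m.round = some m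

namespace IsExecution

variable {s : ℕ → State f α} {e : ℕ → Event f α}

/-- The walk guarantees only that some message fills the slot. That message and the target are both
promised, hence equal. -/
theorem exists_delivered_of_job (h : IsExecution S s e) (hbyz : S.byz.card = f)
    (hcard : ∀ i r, (S.committee i r).card = S.nc) (hmaj : HonestMajority S)
    (hes : EnoughSigners S s) {q : Node f} (hq : q ∉ S.byz) {t d : ℕ} {c m : Msg f α}
    (hc : (d, c) ∈ ((s t).node q).jobs) (hm : c.Reaches m) (hd : m.round ≤ d) :
    ∃ t, ((s t).node q).delivered m.sender m.round = some m := by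
  obtain ⟨t', -, h1⟩ := h.eventually_job_of_reaches hcard hmaj hq hc hm
  obtain ⟨x, hx⟩ := Option.ne_none_iff_exists'.1 (h1 hd)
  have h2 := (h.promised_of_mem_jobs_or_delivered hbyz hcard hmaj hes t' q).2 _ _ _ hx
  have h3 := (h.promised_of_mem_jobs_or_delivered hbyz hcard hmaj hes t q).1 d c hc m hm hd
  obtain ⟨h4, h5, -⟩ := ((h.inv t').loc q).delivered _ _ _ hx
  obtain rfl := h.promised_unique hbyz h2 h3 h4 h5
  exact ⟨t', hx⟩

theorem exists_job_of_quorum (h : IsExecution S s e) {q : Node f} (hq : q ∉ S.byz)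
    {c : Msg f α} (hc : 1 ≤ c.round) {J : Finset (Node f)} (hJ : J.card = 2 * f + 1)
    (hM : ∀ j ∈ J, ∃ m t, ((s t).node q).delivered j (c.round + 1) = some m ∧
      m.prev c.sender = some c) : ∃ t, (c.round, c) ∈ ((s t).node q).jobs := by
  have hall : ∀ᶠ t in atTop, ∀ j ∈ J, ∃ m, ((s t).node q).delivered j (c.round + 1) = some m ∧
      m.prev c.sender = some c := by
    refine (Finset.eventually_all _).2 fun j hj => ?_
    obtain ⟨m, t, h1, h2⟩ := hM j hj
    exact (h.eventually_le t q).mono fun _ hle => ⟨m, hle.delivered _ _ _ h1, h2⟩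
  obtain ⟨t, o, -, hs, -⟩ := h.fair hq (a := .quorum c) (eventually_true _) <| by
    filter_upwards [hall] with t ht
    exact ⟨_, _, .quorum _ c J hc hJ ht⟩
  exact ⟨_, hs.quorum_inv⟩

/-- The array `triggers[]` of a later message of the honest node `p` passes the certificate on to
all honest nodes, even if the certified sender is Byzantine and shows it to `p` only. -/
theorem deliveredByAll_of_trigger [Nonempty α] (h : IsExecution S s e) (hbyz : S.byz.card = f)
    (hcard : ∀ i r, (S.committee i r).card = S.nc) (hmaj : HonestMajority S)
    (hes : EnoughSigners S s) {p : Node f} (hp : p ∉ S.byz) {t : ℕ} {m c : Msg f α}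
    (hm : Promised S s m) (hr : 1 ≤ m.round)
    (hc : ((s t).node p).triggers m.sender = some c) (hround : m.round + S.φ ≤ c.round) :
    DeliveredByAll S s m := by
  intro q hq
  -- a message sent by `p` after time `t`
  obtain ⟨t₁, hlen, ht₁⟩ := ((h.eventually_length_out hbyz hmaj
    (((s t).node p).out.length + 1) hp).and (eventually_ge_atTop t)).exists
  have hv := List.getElem?_eq_getElem
    (show ((s t).node p).out.length < ((s t₁).node p).out.length by omega)
  set v := ((s t₁).node p).out[((s t).node p).out.length]
  have hvm := List.mem_of_getElem? hv
  have hv' : v ∉ ((s t).node p).out := fun hx => by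
    have h1 := (List.getElem?_eq_some_iff.1 (((h.inv t).loc p).mem_out hx).2.2).1
    have h2 := (((h.inv t₁).loc p).out _ _ hv).2
    omega
  obtain ⟨u, hu, hvt⟩ := h.exists_triggers_eq ht₁ hvm hv'
  -- By the time of sending, the entry may have been replaced by one of a later round.
  obtain ⟨c', h1, h2⟩ := ((h.le hu).node p).triggers _ _ hc
  obtain ⟨h3, h4⟩ := ((h.inv u).loc p).triggers _ _ h1
  have hcert : Certified S s c' := ⟨u, ((h.inv u).certs p).triggers _ _ h1⟩
  obtain ⟨m', h5, h6⟩ := h.exists_reaches hcard hmaj hcert hr (by omega)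
  -- The certificate of `c'` need not extend `c`, but its chain still passes through `m`, since it
  -- lies at least `φ` rounds above and promised messages are unique.
  obtain rfl : m = m' := h.promised_unique hbyz hm
    (h.promised_of_reaches hcard hmaj hes hcert h5 (by omega)) (by rw [h5.sender_eq, h3]) h6.symm
  obtain ⟨t₂, h7⟩ := h.eventually_delivered_of_mem_out hbyz hcard hmaj hp hvm hq
  obtain ⟨t₃, o, -, hs, -⟩ := h.fair hq (a := .runCert c') (eventually_true _) <| by
    filter_upwards [h.eventually_le t₂ q] with t' hle
    exact ⟨_, _, .runCert _ c' (Or.inr ⟨_, _, v, hle.delivered _ _ _ h7,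
      by rw [hvt, h3, h1]⟩) h4⟩
  exact h.exists_delivered_of_job hbyz hcard hmaj hes hq hs.runCert_inv h5 (by omega)

theorem deliveredByAll_of_mem_jobs_or_delivered [Nonempty α] (h : IsExecution S s e)
    (hbyz : S.byz.card = f) (hcard : ∀ i r, (S.committee i r).card = S.nc)
    (hmaj : HonestMajority S) (hes : EnoughSigners S s) (t : ℕ) {p : Node f} (hp : p ∉ S.byz) :
    (∀ d c, (d, c) ∈ ((s t).node p).jobs → ∀ m, c.Reaches m → m.round ≤ d →
      DeliveredByAll S s m) ∧
      ∀ i r m, ((s t).node p).delivered i r = some m → DeliveredByAll S s m := by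
  induction t with
  | zero => simp [h.start, State.start, NodeState.start]
  | succ t ih =>
    rcases (h.step t).node_eq_or p with ⟨h1, h2, -⟩ | ⟨-, a, o, -, hstep, -⟩
    · rw [h1, h2]; exact ih
    · refine ⟨fun d c hc m hm hmd => ?_, fun i r m hm => ?_⟩
      · have hcert : Certified S s c := ⟨t + 1, ((h.inv (t + 1)).certs p).jobs d c hc⟩
        have hmp := (h.promised_of_mem_jobs_or_delivered hbyz hcard hmaj hes (t + 1) p).1
          d c hc m hm hmd
        rcases hstep.mem_jobs hc with hc | ⟨b, hb, hbc⟩ | ho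
        · exact ih.1 d c hc m hm hmd
        · exact ih.1 d b hb m (hm.head hbc) hmd
        · cases ho with
          | cert _ c' hφ hc' hround =>
            exact h.deliveredByAll_of_trigger hbyz hcard hmaj hes hp hmp
              (h.one_le_round hcard hmaj (h.certified_of_reaches hcard hmaj hcert hm))
              (by rw [hm.sender_eq]; exact hc') (by omega)
          -- The votes of the honest nodes alone form a quorum, and every honest node delivers them;
          -- the optimistic case at `p` becomes the quorum case at `q`.
          | optimistic _ M hround hM =>
            intro q hq
            obtain ⟨t', ht'⟩ := h.exists_job_of_quorum hq hround (card_honest hbyz)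
              fun j hj => by
                obtain ⟨h1, h2, h3, h4⟩ := hM j
                have hj := (Finset.mem_sdiff.1 hj).2
                have h5 := h.authentic_of_holds h3 (by rwa [h1])
                rw [h1] at h5
                obtain ⟨t', ht'⟩ := h.eventually_delivered_of_mem_out hbyz hcard hmaj hj h5 hq
                exact ⟨M j, t', h2 ▸ ht', h4⟩
            exact h.exists_delivered_of_job hbyz hcard hmaj hes hq ht' hm hmd
          | quorum _ J hround hJ hM =>
            intro q hq
            obtain ⟨t', ht'⟩ := h.exists_job_of_quorum hq hround hJ fun j hj => by
              obtain ⟨v, hv, hv'⟩ := hM j hj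
              obtain ⟨h3, h4, -⟩ := ((h.inv t).loc p).delivered _ _ _ hv
              -- The votes, possibly of Byzantine nodes, were delivered by `p` earlier; by induction
              -- `q` delivers the same ones.
              obtain ⟨t', ht'⟩ := ih.2 _ _ _ hv q hq
              exact ⟨v, t', by rwa [h3, h4] at ht', hv'⟩
            exact h.exists_delivered_of_job hbyz hcard hmaj hes hq ht' hm hmd
      · rcases hstep.delivered_eq_some hm with hm | ⟨d, hd, h1, -⟩
        · exact ih.2 i r m hm
        · exact ih.1 d m hd m .refl h1

theorem totality (h : IsExecution S s e) (hbyz : S.byz.card = f)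
    (hcard : ∀ i r, (S.committee i r).card = S.nc) (hmaj : HonestMajority S)
    (hes : EnoughSigners S s) : Totality S s := by
  intro i r m p hp t hm q hq
  -- Liveness needs some content for new messages; the delivered message supplies one.
  have : Nonempty α := by
    obtain ⟨body, -, -, -, -, -⟩ := m
    exact ⟨body⟩
  obtain ⟨rfl, rfl, -⟩ := ((h.inv t).loc p).delivered _ _ _ hm
  exact (h.deliveredByAll_of_mem_jobs_or_delivered hbyz hcard hmaj hes t hp).2 _ _ _ hm q hq

end IsExecution

/-! ### Transfer to probabilities -/

theorem HoldsWithProb.mono_ae {Ω : Type*} [MeasurableSpace Ω] {μ : Measure Ω}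
    [IsFiniteMeasure μ] {x : ℝ} {A B : Set Ω} (h : HoldsWithProb μ x A)
    (hAB : ∀ᵐ ω ∂μ, ω ∈ A → ω ∈ B) : HoldsWithProb μ x B := by
  obtain ⟨C, hC, hCA, hx⟩ := h
  -- The exceptional set need not be measurable, so a measurable null set containing it is removed
  -- from the witness.
  obtain ⟨N, hN, hNm, hN0⟩ := exists_measurable_superset_of_null (ae_iff.1 hAB)
  refine ⟨C \ N, hC.diff hNm, fun ω hω => ?_, ?_⟩
  · by_contra hB
    exact hω.2 (hN fun hcon => hB (hcon (hCA hω.1)))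
  · rwa [measureReal_def, measure_sdiff_null hN0]

end APMBRB

theorem mainTheorem5 {Ω : Type*} [MeasurableSpace Ω] (μ : Measure Ω) [IsProbabilityMeasure μ]
    {α : Type*} (f φ nc : ℕ) (hφ : 0 < φ) (ε : ℝ)
    (byz : Finset (APMBRB.Node f)) (hbyz : byz.card = f)
    (sample : Ω → APMBRB.Node f → ℕ → Finset (APMBRB.Node f))
    (hsample : ∀ ω i k, (sample ω i k).card = nc)
    (s : Ω → ℕ → APMBRB.State f α) (e : Ω → ℕ → APMBRB.Event f α)
    (hexec : ∀ᵐ ω ∂μ, APMBRB.IsExecution ⟨byz, φ, nc, sample ω⟩ (s ω) (e ω))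
    (hgood : APMBRB.HoldsWithProb μ (1 - ε)
      {ω | APMBRB.HonestMajority ⟨byz, φ, nc, sample ω⟩ ∧
        APMBRB.EnoughSigners ⟨byz, φ, nc, sample ω⟩ (s ω)}) :
    APMBRB.HoldsWithProb μ (1 - ε) {ω | APMBRB.Totality ⟨byz, φ, nc, sample ω⟩ (s ω)} := by
  refine hgood.mono_ae ?_
  filter_upwards [hexec] with ω hω hg
  exact hω.totality hbyz (fun i r => hsample ω i _) hg.1 hg.2
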